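/- Let $R$ be a ring (associative, with $1$). For a module $M$, $\mathrm{soc}(M)$ is the sum of its simple submodules and $\mathrm{top}(M)=M/\mathrm{rad}(M)$, where $\mathrm{rad}(M)$ is the intersection of its maximal submodules. Put $S_r=\mathrm{soc}(R_R)$ and $S_l=\mathrm{soc}({}_RR)$; these are two-sided ideals. Put $l(X)=\{a\in R: aX=0\}$ and $r(X)=\{a\in R: Xa=0\}$. The ring $R$ has essential socles if $S_r$ meets every nonzero right ideal nontrivially and $S_l$ meets every nonzero left ideal nontrivially. It is right Kasch if every simple right module is isomorphic to a right ideal of $R$. Let $R$ be semiperfect, i.e. $1=e_1+\dots+e_m$ with pairwise orthogonal idempotents $e_i$ that are local (the ring $\mathrm{End}_R(e_iR)$ is local). Fix such a decomposition, ordered so that each $e_iR$ $(i\le m)$ is isomorphic to exactly one of the basic right ideals $e_1R,\dots,e_nR$. For $k\le n$ let $\mu_k$ be the number of $i\le m$ with $e_iR\cong e_kR$, let $V_k=\mathrm{top}(e_kR)$ and $V'_k=\mathrm{top}(Re_k)$, and let $S_k$ (resp. $S'_k$) be the sum of all simple right (resp. left) ideals isomorphic to $V_k$ (resp. $V'_k$).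 A permutation $\pi$ of $\{1,\dots,n\}$ is a Nakayama permutation of $R$ if $\mathrm{soc}(e_kR)\cong\mathrm{top}(e_{\pi(k)}R)$ and $\mathrm{soc}(Re_{\pi(k)})\cong\mathrm{top}(Re_k)$ for all $k\le n$; it respects the multiplicities if $\mu_k=\mu_{\pi(k)}$ for all $k\le n$. The generalised dimension $d$ of a right (resp. left) module of finite length is the sum, over the factors of a composition series, of the values obtained by assigning $\mu_k$ to $V_k$ (resp. to $V'_k$). A right ideal $I$ satisfies the Generalised dimension condition if $d(I)$ and $d(R/l(I))$ are finite and equal ($I$ as a right module, $R/l(I)$ as a left module). A left ideal $I'$ satisfies it if $d(I')$ and $d(R/r(I'))$ are finite and equal ($I'$ as a left module, $R/r(I')$ as a right module). Let $R$ be a semiperfect ring with essential socles. The following are equivalent: (1) $R$ has a Nakayama permutation respecting the multiplicities. (2) $S_l\cong\mathrm{top}({}_RR)$ as left modules and $S_r\cong\mathrm{top}(R_R)$ as right modules. (3) $R$ is right Kasch; $S_r$ satisfies the Generalised dimension condition as a left ideal and $S_l$ satisfies it as a right ideal; and, for every $k\le n$, $S_k$ satisfies it as a right ideal and $S'_k$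 satisfies it as a left ideal. -/

import Mathlib

universe u v w

namespace SemiperfectRing

/-! Right modules over `R` are modules over `Rᵐᵒᵖ`; right ideals are `Submodule Rᵐᵒᵖ R`,
left ideals are `Submodule R R`. -/

section Modules

variable (S : Type u) [Ring S] (M : Type v) [AddCommGroup M] [Module S M]

/-- The socle of a module: the sum of its simple submodules. -/
def socle : Submodule S M := sSup {N : Submodule S M | IsSimpleModule S N}

/-- The top of a module: its quotient by its radical (the intersection of the maximal
submodules). For `M = R`, on either side, the radical is the Jacobson radical `J(R)`. -/
abbrev ModuleTop : Type v := M ⧸ Module.jacobson S M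

variable {S M} in
/-- A submodule is essential if it meets every nonzero submodule nontrivially. -/
def IsEssential (N : Submodule S M) : Prop :=
  ∀ K : Submodule S M, K ≠ ⊥ → N ⊓ K ≠ ⊥

/-- `HasLength S M V μ d`: the module `M` has finite length and its value under the length
function that assigns `μ k` to the simple module `V k` is `d`: there is a composition series
of `M` whose `i`-th factor is isomorphic to `V (c i)`, and `d` is the sum of the `μ (c i)`. -/
def HasLength {ι : Type} (V : ι → Type w) [∀ k, AddCommGroup (V k)] [∀ k, Module S (V k)]
    (μ : ι → ℕ) (d : ℕ) : Prop :=
  ∃ s : CompositionSeries (Submodule S M), s.head = ⊥ ∧ s.last = ⊤ ∧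
    ∃ c : Fin s.length → ι,
      (∀ i : Fin s.length, Nonempty
        ((↥(s i.succ) ⧸ (s i.castSucc).submoduleOf (s i.succ)) ≃ₗ[S] V (c i))) ∧
      ∑ i, μ (c i) = d

end Modules

section Rings

variable {R : Type u} [Ring R]

/-- The principal right ideal `eR`. -/
abbrev principalRight (e : R) : Submodule Rᵐᵒᵖ R := Submodule.span Rᵐᵒᵖ {e}

/-- The principal left ideal `Re`. -/
abbrev principalLeft (e : R) : Submodule R R := Submodule.span R {e}

/-- An idempotent `e` is local if the endomorphism ring of `eR` is a local ring. -/
def IsLocalIdempotent (e : R) : Prop :=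
  IsIdempotentElem e ∧ IsLocalRing (Module.End Rᵐᵒᵖ (principalRight e))

variable (R) in
/-- A ring is semiperfect if `1` is a finite sum of pairwise orthogonal local idempotents. -/
def IsSemiperfect : Prop :=
  ∃ (m : ℕ) (e : Fin m → R), CompleteOrthogonalIdempotents e ∧ ∀ i, IsLocalIdempotent (e i)

variable (R) in
/-- The right socle `S_r`. -/
abbrev rightSocle : Submodule Rᵐᵒᵖ R := socle Rᵐᵒᵖ R

variable (R) in
/-- The left socle `S_l`. -/
abbrev leftSocle : Submodule R R := socle R R

theorem map_socle_le {S : Type u} [Ring S] {M : Type v} [AddCommGroup M] [Module S M]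
    (f : M →ₗ[S] M) : (socle S M).map f ≤ socle S M := by
  unfold socle
  rw [Submodule.map_le_iff_le_comap]
  refine sSup_le fun N hN => ?_
  rw [← Submodule.map_le_iff_le_comap]
  have : IsSimpleModule S N := hN
  rcases LinearMap.injective_or_eq_zero (f.domRestrict N) with h | h
  · refine le_sSup ?_
    have e : N ≃ₗ[S] (N.map f) :=
      (LinearEquiv.ofInjective _ h).trans
        (LinearEquiv.ofEq _ _ (by rw [LinearMap.range_domRestrict]))
    exact IsSimpleModule.congr e.symm
  · rw [← LinearMap.range_domRestrict, h, LinearMap.range_zero]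
    exact bot_le

variable (R) in
/-- The right socle, which is a two-sided ideal, as a left ideal. -/
def rightSocleAsLeft : Submodule R R where
  carrier := rightSocle R
  add_mem' := (rightSocle R).add_mem
  zero_mem' := (rightSocle R).zero_mem
  smul_mem' r _ hx :=
    map_socle_le
      { toFun := fun y => r * y
        map_add' := mul_add r
        map_smul' := fun s y => mul_smul_comm s r y }
      (Submodule.mem_map_of_mem hx)

variable (R) in
/-- The left socle, which is a two-sided ideal, as a right ideal. -/
def leftSocleAsRight : Submodule Rᵐᵒᵖ R where
  carrier := leftSocle R
  add_mem' := (leftSocle R).add_mem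
  zero_mem' := (leftSocle R).zero_mem
  smul_mem' r _ hx :=
    map_socle_le (LinearMap.toSpanSingleton R R r.unop) (Submodule.mem_map_of_mem hx)

/-- The left annihilator `l(X) = {r | rX = 0}`. -/
def leftAnn (X : Set R) : Submodule R R where
  carrier := {r | ∀ x ∈ X, r * x = 0}
  add_mem' ha hb x hx := by rw [add_mul, ha x hx, hb x hx, add_zero]
  zero_mem' x _ := zero_mul x
  smul_mem' c a ha x hx := by rw [smul_eq_mul, mul_assoc, ha x hx, mul_zero]

/-- The right annihilator `r(X) = {r | Xr = 0}`. -/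
def rightAnn (X : Set R) : Submodule Rᵐᵒᵖ R where
  carrier := {r | ∀ x ∈ X, x * r = 0}
  add_mem' ha hb x hx := by rw [mul_add, ha x hx, hb x hx, add_zero]
  zero_mem' x _ := mul_zero x
  smul_mem' c a ha x hx := by
    rw [← MulOpposite.op_unop c, op_smul_eq_mul, ← mul_assoc, ha x hx, zero_mul]

variable (R) in
/-- `R` is right Kasch if every simple right module is isomorphic to a right ideal. -/
def IsRightKasch : Prop :=
  ∀ (T : Type u) [AddCommGroup T] [Module Rᵐᵒᵖ T] [IsSimpleModule Rᵐᵒᵖ T],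
    ∃ I : Submodule Rᵐᵒᵖ R, Nonempty (T ≃ₗ[Rᵐᵒᵖ] I)

end Rings

/-- The notation fixed for a semiperfect ring: a decomposition of `1` into `m` pairwise
orthogonal local idempotents `e i`, together with indices `rep k`, for `k` in `Fin n`, such that
the `e (rep k)` are a basic set of idempotents: every `e i R` is isomorphic to
`e (rep k) R` for exactly one `k`. -/
structure BasicSystem (R : Type u) [Ring R] where
  /-- The order of the ring. -/
  m : ℕ
  /-- The number of basic idempotents. -/
  n : ℕ
  /-- The local idempotents. -/
  e : Fin m → R
  complete : CompleteOrthogonalIdempotents e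
  isLocal : ∀ i, IsLocalIdempotent (e i)
  /-- The indices of the basic idempotents. -/
  rep : Fin n → Fin m
  existsUnique_rep : ∀ i, ∃! k,
    Nonempty (principalRight (e i) ≃ₗ[Rᵐᵒᵖ] principalRight (e (rep k)))

/-- The semiperfect rings are exactly those for which such a choice of notation exists. -/
theorem isSemiperfect_iff_nonempty_basicSystem (R : Type u) [Ring R] :
    IsSemiperfect R ↔ Nonempty (BasicSystem R) := by
  constructor
  · rintro ⟨m, e, he, hl⟩
    let r : Setoid (Fin m) :=
      { r := fun i j => Nonempty (principalRight (e i) ≃ₗ[Rᵐᵒᵖ] principalRight (e j))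
        iseqv := ⟨fun _ => ⟨LinearEquiv.refl _ _⟩, fun ⟨f⟩ => ⟨f.symm⟩,
          fun ⟨f⟩ ⟨g⟩ => ⟨f.trans g⟩⟩ }
    obtain ⟨n, ⟨φ⟩⟩ := Finite.exists_equiv_fin (Quotient r)
    refine ⟨⟨m, n, e, he, hl, fun k => (φ.symm k).out, fun i => ⟨φ (Quotient.mk r i), ?_, ?_⟩⟩⟩
    · have : r i (φ.symm (φ (Quotient.mk r i))).out := by
        rw [Equiv.symm_apply_apply]
        exact Setoid.symm' r (Quotient.mk_out i)
      exact this
    · intro k hk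
      have h : Quotient.mk r i = Quotient.mk r (φ.symm k).out := Quotient.sound hk
      rw [h, Quotient.out_eq, Equiv.apply_symm_apply]
  · rintro ⟨E⟩
    exact ⟨E.m, E.e, E.complete, E.isLocal⟩

namespace BasicSystem

variable {R : Type u} [Ring R] (E : BasicSystem R)

/-- The basic right ideal `e_k R`. -/
abbrev rightIdeal (k : Fin E.n) : Submodule Rᵐᵒᵖ R := principalRight (E.e (E.rep k))

/-- The basic left ideal `R e_k`. -/
abbrev leftIdeal (k : Fin E.n) : Submodule R R := principalLeft (E.e (E.rep k))

/-- The simple right module `V_k = top(e_k R)`. -/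
abbrev V (k : Fin E.n) : Type u := ModuleTop Rᵐᵒᵖ (E.rightIdeal k)

/-- The simple left module `V'_k = top(R e_k)`. -/
abbrev V' (k : Fin E.n) : Type u := ModuleTop R (E.leftIdeal k)

/-- The multiplicity `μ_k`: the number of indices `i` with `e_i R` isomorphic to `e_k R`. -/
noncomputable def mult (k : Fin E.n) : ℕ :=
  Nat.card {i : Fin E.m // Nonempty (principalRight (E.e i) ≃ₗ[Rᵐᵒᵖ] E.rightIdeal k)}

/-- `soc(e_k R) ≅ top(e_{π(k)} R)` and `soc(R e_{π(k)}) ≅ top(R e_k)` for all `k`. -/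
def IsNakayama (π : Equiv.Perm (Fin E.n)) : Prop :=
  ∀ k, Nonempty (socle Rᵐᵒᵖ (E.rightIdeal k) ≃ₗ[Rᵐᵒᵖ] ModuleTop Rᵐᵒᵖ (E.rightIdeal (π k))) ∧
    Nonempty (socle R (E.leftIdeal (π k)) ≃ₗ[R] ModuleTop R (E.leftIdeal k))

/-- The permutation `π` respects the multiplicities. -/
def RespectsMultiplicities (π : Equiv.Perm (Fin E.n)) : Prop :=
  ∀ k, E.mult k = E.mult (π k)

/-- The homogeneous component `S_k` of the right socle: the sum of all simple right ideals
isomorphic to `V_k`. -/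
abbrev rightComponent (k : Fin E.n) : Submodule Rᵐᵒᵖ R := isotypicComponent Rᵐᵒᵖ R (E.V k)

/-- The homogeneous component `S'_k` of the left socle: the sum of all simple left ideals
isomorphic to `V'_k`. -/
abbrev leftComponent (k : Fin E.n) : Submodule R R := isotypicComponent R R (E.V' k)

/-- The right module `M` has finite generalised dimension `d`. -/
def RightDim (M : Type u) [AddCommGroup M] [Module Rᵐᵒᵖ M] (d : ℕ) : Prop :=
  HasLength Rᵐᵒᵖ M E.V E.mult d

/-- The left module `M` has finite generalised dimension `d`. -/
def LeftDim (M : Type u) [AddCommGroup M] [Module R M] (d : ℕ) : Prop :=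
  HasLength R M E.V' E.mult d

/-- The generalised dimension condition for a right ideal `I`: the generalised dimensions of
the right module `I` and of the left module `R / l(I)` are finite and equal. -/
def RightGDC (I : Submodule Rᵐᵒᵖ R) : Prop :=
  ∃ d, E.RightDim I d ∧ E.LeftDim (R ⧸ leftAnn (I : Set R)) d

/-- The generalised dimension condition for a left ideal `I`: the generalised dimensions of
the left module `I` and of the right module `R / r(I)` are finite and equal. -/
def LeftGDC (I : Submodule R R) : Prop :=
  ∃ d, E.LeftDim I d ∧ E.RightDim (R ⧸ rightAnn (I : Set R)) d

end BasicSystem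

end SemiperfectRing

/-! For a left module `M`, the length of `Hom(R e_i, M) ≅ e_i M` over `e_i R e_i` counts the
composition factors `top(R e_i)` of `M`. Its sum over all `i ≤ m` is `dim M`: an idempotent is
counted once for each isomorphic copy, so `V'_k` receives `μ_k` and `dim` is the generalised
dimension. It is additive and takes values in `ℕ∞`. The ring is treated as a `PeirceSystem`, in
which `S` and `T` act from opposite sides, so that each argument serves for both sides through
`flip`. In the comments `S` acts from the left and `T` from the right, hence `socle S A` is `S_l`
and `socle T A` is `S_r`; `Linked Z i k` says `e_i Z e_k ≠ 0`.

All conditions are compared with `HasSimpleSocles`: the socles coincide in an ideal `Z`, every `Z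
e_k` and every `e_i Z` is simple, and `e_i Z e_k ≠ 0` forces `μ_i = μ_k`. Then the nonzero
components `e_i Z e_k` match isomorphism classes bijectively, which is the Nakayama permutation
(`exists_perm`), and every dimension in (3) can be computed.

(1) implies (2) because a semisimple module of finite dimension is determined by its multiplicities
(`nonempty_equiv_of_homLength_eq`). Under (2), `S_l` has length `m` and is the direct sum of the `m`
nonzero modules `S_l e_k`, so these are simple; essentiality then gives `S_l = S_r`
(`hasSimpleSocles_of_equiv`).

For (3), let `a` be the length of `S_r e_k` over `e_k R e_k`, and suppose `S_r e_k ≠ 0`. Evaluation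
at `a` generators embeds `R/l(S_k)` into `(S_r e_k)^a` (`exists_hom_ker_eq_ann`), so the condition
on `S_k` reads `μ_k a = d(R/l(S_k)) ≤ a d(S_r e_k)`. Summing `μ_k ≤ d(S_r e_k)` over `k`, the
condition on `S_r` forces equality everywhere. The embedding is thus an isomorphism, and counting
simple quotients shows that the `i` with `e_i S_r e_k ≠ 0` form one isomorphism class, with `μ_i ≤
μ_k` (`linked_iff_iso_of_dim`). The other side gives the reverse inequality, and essentiality joins
the two (`hasSimpleSocles_of_dim`). -/

namespace SemiperfectRing

/-! ### Lengths of Hom modules as multiplicities -/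

section HomLength

variable {S : Type u} [Ring S]

/-- `Hom(P, M)` is a right module over the endomorphism ring of `P`. -/
instance homModule (P : Type*) [AddCommGroup P] [Module S P]
    (M : Type*) [AddCommGroup M] [Module S M] :
    Module (Module.End S P)ᵐᵒᵖ (P →ₗ[S] M) where
  smul a f := f ∘ₗ a.unop
  one_smul _ := rfl
  mul_smul _ _ _ := rfl
  smul_zero _ := rfl
  smul_add _ _ _ := rfl
  add_smul a b f := LinearMap.comp_add a.unop b.unop f
  zero_smul f := LinearMap.comp_zero f

/-- The length of `Hom(P, M)` over the endomorphism ring of `P`. If `P` is projective and local,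
it is the multiplicity of the top of `P` in `M`. -/
noncomputable def homLength (P : Type v) [AddCommGroup P] [Module S P]
    (M : Type w) [AddCommGroup M] [Module S M] : ℕ∞ :=
  Module.length (Module.End S P)ᵐᵒᵖ (P →ₗ[S] M)

variable (P : Type*) [AddCommGroup P] [Module S P]
variable {M N Q : Type*} [AddCommGroup M] [Module S M] [AddCommGroup N] [Module S N]
  [AddCommGroup Q] [Module S Q]

/-- Composition with a linear map, as a map linear over the endomorphisms of the source. -/
def homMap (f : M →ₗ[S] N) : (P →ₗ[S] M) →ₗ[(Module.End S P)ᵐᵒᵖ] (P →ₗ[S] N) where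
  toFun g := f ∘ₗ g
  map_add' g h := LinearMap.comp_add g h f
  map_smul' _ _ := rfl

theorem homMap_injective {f : M →ₗ[S] N} (hf : Function.Injective f) :
    Function.Injective (homMap P f) := fun g h hgh => by
  ext x
  exact hf (LinearMap.congr_fun hgh x)

theorem homMap_surjective [Module.Projective S P] {f : M →ₗ[S] N}
    (hf : Function.Surjective f) : Function.Surjective (homMap P f) := fun g =>
  Module.projective_lifting_property f g hf

theorem homLength_congr (e : M ≃ₗ[S] N) : homLength (S := S) P M = homLength (S := S) P N :=
  (LinearEquiv.ofBijective (homMap P e.toLinearMap)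
    ⟨homMap_injective P e.injective, fun g => ⟨e.symm.toLinearMap ∘ₗ g, by
      ext x; exact e.apply_symm_apply _⟩⟩).length_eq

theorem homLength_le_of_injective (f : M →ₗ[S] N) (hf : Function.Injective f) :
    homLength (S := S) P M ≤ homLength (S := S) P N :=
  Module.length_le_of_injective (homMap P f) (homMap_injective P hf)

theorem homLength_le_of_surjective [Module.Projective S P] (f : M →ₗ[S] N)
    (hf : Function.Surjective f) : homLength (S := S) P N ≤ homLength (S := S) P M :=
  Module.length_le_of_surjective (homMap P f) (homMap_surjective P hf)

theorem homLength_eq_add_of_exact [Module.Projective S P] (f : N →ₗ[S] M) (g : M →ₗ[S] Q)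
    (hf : Function.Injective f) (hg : Function.Surjective g) (h : Function.Exact f g) :
    homLength (S := S) P M = homLength (S := S) P N + homLength (S := S) P Q := by
  refine Module.length_eq_add_of_exact (homMap P f) (homMap P g) (homMap_injective P hf)
    (homMap_surjective P hg) fun k => ⟨fun hk => ?_, ?_⟩
  · have hk' : ∀ x, k x ∈ LinearMap.range f := fun x =>
      (h (k x)).1 (LinearMap.congr_fun hk x)
    refine ⟨(LinearEquiv.ofInjective f hf).symm.toLinearMap ∘ₗ k.codRestrict _ hk', ?_⟩
    ext x
    exact congrArg Subtype.val
      ((LinearEquiv.ofInjective f hf).apply_symm_apply ⟨k x, hk' x⟩)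
  · rintro ⟨l, rfl⟩
    ext x
    exact h.apply_apply_eq_zero (l x)

theorem homLength_eq_add_quotient [Module.Projective S P] (K : Submodule S M) :
    homLength (S := S) P M = homLength (S := S) P K + homLength (S := S) P (M ⧸ K) :=
  homLength_eq_add_of_exact P K.subtype K.mkQ K.subtype_injective K.mkQ_surjective
    (LinearMap.exact_subtype_mkQ K)

theorem homLength_pi {ι : Type*} [Fintype ι] (M : ι → Type*) [∀ i, AddCommGroup (M i)]
    [∀ i, Module S (M i)] :
    homLength (S := S) P (∀ i, M i) = ∑ i, homLength (S := S) P (M i) := by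
  have e : (P →ₗ[S] ∀ i, M i) ≃ₗ[(Module.End S P)ᵐᵒᵖ] (∀ i, P →ₗ[S] M i) :=
    { toFun f i := LinearMap.proj i ∘ₗ f
      invFun f := LinearMap.pi f
      map_add' _ _ := rfl
      map_smul' _ _ := rfl
      left_inv _ := rfl
      right_inv _ := rfl }
  exact e.length_eq.trans (Module.length_pi_of_fintype _ _)

theorem homLength_eq_zero_iff : homLength (S := S) P M = 0 ↔ ∀ f : P →ₗ[S] M, f = 0 := by
  rw [homLength, Module.length_eq_zero_iff]
  exact ⟨fun h f => Subsingleton.elim _ _, fun h => ⟨fun f g => by rw [h f, h g]⟩⟩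

/-- A nonzero `f` is surjective, so by projectivity every map `P → M` factors through it: each
nonzero element generates the Hom module over the endomorphism ring. -/
theorem homLength_eq_one [Module.Projective S P] [IsSimpleModule S M] {f : P →ₗ[S] M}
    (hf : f ≠ 0) : homLength (S := S) P M = 1 := by
  rw [homLength, Module.length_eq_one_iff, isSimpleModule_iff_toSpanSingleton_surjective]
  refine ⟨⟨f, 0, hf⟩, fun g hg h => ?_⟩
  obtain ⟨k, hk⟩ := Module.projective_lifting_property g h (LinearMap.surjective_of_ne_zero hg)
  exact ⟨MulOpposite.op k, hk⟩

/-- `homLength` depends on its first argument only up to isomorphism. -/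
theorem homLength_congr_left {P P' : Type*} [AddCommGroup P] [Module S P] [AddCommGroup P']
    [Module S P'] (e : P ≃ₗ[S] P') : homLength (S := S) P M = homLength (S := S) P' M := by
  let σ : (Module.End S P)ᵐᵒᵖ ≃+* (Module.End S P')ᵐᵒᵖ := RingEquiv.op e.conjRingEquiv
  have : RingHomInvPair (σ : (Module.End S P)ᵐᵒᵖ →+* (Module.End S P')ᵐᵒᵖ) σ.symm :=
    RingHomInvPair.of_ringEquiv σ
  have : RingHomInvPair (σ.symm : (Module.End S P')ᵐᵒᵖ →+* (Module.End S P)ᵐᵒᵖ) σ :=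
    RingHomInvPair.of_ringEquiv σ.symm
  let f : (P →ₗ[S] M) ≃ₛₗ[(σ : (Module.End S P)ᵐᵒᵖ →+* (Module.End S P')ᵐᵒᵖ)] (P' →ₗ[S] M) :=
    { toFun g := g ∘ₗ e.symm.toLinearMap
      invFun g := g ∘ₗ e.toLinearMap
      map_add' _ _ := rfl
      map_smul' a g := by
        ext x
        change g (a.unop (e.symm x)) = g (e.symm (e (a.unop (e.symm x))))
        rw [e.symm_apply_apply]
      left_inv g := by ext x; exact congrArg g (e.symm_apply_apply x)
      right_inv g := by ext x; exact congrArg g (e.apply_symm_apply x) }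
  -- `f` is only semilinear over `σ`, so the lengths are compared through the lattices of
  -- submodules.
  have := Order.krullDim_eq_of_orderIso (Submodule.orderIsoMapComap f)
  rw [← Module.coe_length, ← Module.coe_length] at this
  exact_mod_cast this

end HomLength

/-! ### Generators of modules of finite length -/

section LengthGenerators

/-- A module of finite length `n` is generated by `n` elements. -/
theorem exists_fin_span_eq_top {B : Type*} [Ring B] (n : ℕ) :
    ∀ (M : Type v) [AddCommGroup M] [Module B M], Module.length B M = n →
      ∃ x : Fin n → M, Submodule.span B (Set.range x) = ⊤ := by
  induction n with
  | zero =>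
    intro M _ _ h
    have : Subsingleton M := Module.length_eq_zero_iff.1 h
    exact ⟨fun _ => 0, Subsingleton.elim _ _⟩
  | succ n ih =>
    intro M _ _ h
    have hfin : IsFiniteLength B M := Module.length_ne_top_iff.1 (by rw [h]; exact ENat.natCast_ne_top _)
    obtain ⟨_, _⟩ := isFiniteLength_iff_isNoetherian_isArtinian.1 hfin
    have : Nontrivial M := by
      rw [← Module.length_pos_iff (R := B), h]; exact_mod_cast Nat.succ_pos n
    obtain ⟨N, hN⟩ := IsAtomic.exists_atom (Submodule B M)
    have hNs : IsSimpleModule B N := isSimpleModule_iff_isAtom.2 hN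
    have hadd := Module.length_eq_add_of_exact N.subtype N.mkQ N.subtype_injective
      N.mkQ_surjective (LinearMap.exact_subtype_mkQ N)
    rw [h, Module.length_eq_one] at hadd
    have hq : Module.length B (M ⧸ N) = n := by
      generalize Module.length B (M ⧸ N) = L at hadd ⊢
      cases L with
      | top => exact absurd hadd (by simp)
      | coe L => norm_cast at hadd ⊢; omega
    obtain ⟨y, hy⟩ := ih (M ⧸ N) hq
    choose x hx using fun i => N.mkQ_surjective (y i)
    obtain ⟨z, hz, hz0⟩ := N.ne_bot_iff.1 hN.1
    -- `z` generates a simple submodule and `x` lifts generators of the quotient by it.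
    refine ⟨Fin.cons z x, ?_⟩
    rw [Fin.range_cons, Submodule.span_insert]
    have hzN : Submodule.span B {z} = N := by
      refine (hN.le_iff.1 ((Submodule.span_singleton_le_iff_mem _ _).2 hz)).resolve_left ?_
      rwa [Submodule.span_singleton_eq_bot]
    rw [hzN, eq_top_iff]
    intro m _
    have hm : N.mkQ m ∈ Submodule.map N.mkQ (Submodule.span B (Set.range x)) := by
      rw [Submodule.map_span, ← Set.range_comp]
      have : (N.mkQ ∘ x) = y := funext hx
      rw [this, hy]; trivial
    obtain ⟨m', hm', hmm⟩ := hm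
    rw [← sub_add_cancel m m']
    refine Submodule.add_mem_sup ?_ hm'
    rw [← N.ker_mkQ, LinearMap.mem_ker, map_sub, hmm, sub_self]

end LengthGenerators

/-! ### Local modules and projective covers of simple modules -/

section LocalModule

variable (S : Type u) [Ring S] (P : Type v) [AddCommGroup P] [Module S P]

/-- A nonzero finitely generated module whose proper submodules have proper sums. -/
structure IsLocalModule : Prop where
  nontrivial : Nontrivial P
  finite : Module.Finite S P
  eq_top_or : ∀ U W : Submodule S P, U ⊔ W = ⊤ → U = ⊤ ∨ W = ⊤

variable {S P}
variable {V M : Type*} [AddCommGroup V] [Module S V] [AddCommGroup M] [Module S M]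

namespace IsLocalModule

theorem eq_of_isCoatom (h : IsLocalModule S P) {U W : Submodule S P} (hU : IsCoatom U)
    (hW : IsCoatom W) : U = W := by
  by_contra hne
  rcases h.eq_top_or U W (hU.sup_eq_top_of_ne hW hne) with h | h
  · exact hU.1 h
  · exact hW.1 h

theorem isCoatom_jacobson (h : IsLocalModule S P) : IsCoatom (Module.jacobson S P) := by
  have := h.nontrivial
  have := h.finite
  obtain ⟨U, hU⟩ := IsCoatomic.exists_coatom (Submodule S P)
  have : Module.jacobson S P = U :=
    le_antisymm (sInf_le hU) (le_sInf fun W hW => (h.eq_of_isCoatom hU hW).le)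
  rwa [this]

theorem eq_jacobson (h : IsLocalModule S P) {U : Submodule S P} (hU : IsCoatom U) :
    U = Module.jacobson S P := h.eq_of_isCoatom hU h.isCoatom_jacobson

theorem isSimpleModule_top (h : IsLocalModule S P) : IsSimpleModule S (ModuleTop S P) :=
  isSimpleModule_iff_isCoatom.2 h.isCoatom_jacobson

theorem eq_top_of_sup_jacobson (h : IsLocalModule S P) {U : Submodule S P}
    (hU : U ⊔ Module.jacobson S P = ⊤) : U = ⊤ :=
  (h.eq_top_or _ _ hU).resolve_right h.isCoatom_jacobson.1

theorem nonempty_top_equiv (h : IsLocalModule S P) [IsSimpleModule S V] {f : P →ₗ[S] V}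
    (hf : f ≠ 0) : Nonempty (ModuleTop S P ≃ₗ[S] V) := by
  have hs := LinearMap.surjective_of_ne_zero hf
  exact ⟨(Submodule.quotEquivOfEq _ _
    (h.eq_jacobson (LinearMap.isCoatom_ker_of_surjective hs)).symm).trans
      (f.quotKerEquivOfSurjective hs)⟩

end IsLocalModule

theorem jacobson_le_ker_of_isSemisimpleModule [IsSemisimpleModule S M] (f : P →ₗ[S] M) :
    Module.jacobson S P ≤ LinearMap.ker f := by
  intro x hx
  have := Module.map_jacobson_le f (Submodule.mem_map_of_mem hx)
  rwa [IsSemisimpleModule.jacobson_eq_bot] at this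

theorem IsLocalModule.nonempty_top_equiv_range (h : IsLocalModule S P) [IsSemisimpleModule S M]
    {f : P →ₗ[S] M} (hf : f ≠ 0) : Nonempty (ModuleTop S P ≃ₗ[S] LinearMap.range f) := by
  have hle := jacobson_le_ker_of_isSemisimpleModule f
  have hker : LinearMap.ker f = Module.jacobson S P := by
    refine ((h.isCoatom_jacobson.le_iff).1 hle).resolve_left fun h0 => hf ?_
    exact LinearMap.ker_eq_top.1 h0
  exact ⟨(Submodule.quotEquivOfEq _ _ hker.symm).trans f.quotKerEquivRange⟩

/-- A local projective module is determined up to isomorphism by its top. -/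
theorem IsLocalModule.nonempty_equiv_of_top {P' : Type*} [AddCommGroup P'] [Module S P']
    [Module.Projective S P] [Module.Projective S P'] (h : IsLocalModule S P)
    (h' : IsLocalModule S P') (e : ModuleTop S P ≃ₗ[S] ModuleTop S P') :
    Nonempty (P ≃ₗ[S] P') := by
  obtain ⟨g, hg⟩ := Module.projective_lifting_property (Module.jacobson S P').mkQ
    (e.toLinearMap ∘ₗ (Module.jacobson S P).mkQ) (Submodule.mkQ_surjective _)
  -- Nakayama's argument: the range of `g` and the radical together span `P'`, hence the range is
  -- everything.
  have hgs : Function.Surjective g := by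
    rw [← LinearMap.range_eq_top]
    refine h'.eq_top_of_sup_jacobson ?_
    rw [eq_top_iff]
    intro y _
    obtain ⟨x, hx⟩ := (e.surjective.comp (Submodule.mkQ_surjective _)) (Submodule.mkQ _ y)
    rw [← add_sub_cancel (g x) y]
    refine Submodule.add_mem_sup ⟨x, rfl⟩ ?_
    rw [← (Module.jacobson S P').ker_mkQ, LinearMap.mem_ker, map_sub, ← hx, sub_eq_zero]
    exact (LinearMap.congr_fun hg x).symm
  obtain ⟨k, hk⟩ := Module.projective_lifting_property g LinearMap.id hgs
  have hsup : LinearMap.range k ⊔ LinearMap.ker g = ⊤ := by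
    rw [eq_top_iff]
    intro x _
    rw [← add_sub_cancel (k (g x)) x]
    refine Submodule.add_mem_sup ⟨_, rfl⟩ ?_
    rw [LinearMap.mem_ker, map_sub, sub_eq_zero]
    exact (LinearMap.congr_fun hk (g x)).symm
  have hkinj : Function.Injective k :=
    Function.LeftInverse.injective (g := g) fun x => LinearMap.congr_fun hk x
  -- The splitting `k` gives `P = range k + ker g`. As `P` is local, one summand is all of `P`, and
  -- `ker g` is not, because `g` maps onto a nonzero module.
  rcases h.eq_top_or _ _ hsup with h0 | h0
  · exact ⟨(LinearEquiv.ofBijective k ⟨hkinj, LinearMap.range_eq_top.1 h0⟩).symm⟩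
  · have := h'.nontrivial
    obtain ⟨y, hy⟩ := exists_ne (0 : P')
    obtain ⟨x, rfl⟩ := hgs y
    exact absurd (LinearMap.mem_ker.1 (h0 ▸ Submodule.mem_top (x := x))) hy

theorem homLength_top {P' : Type*} [AddCommGroup P'] [Module S P']
    [Module.Projective S P] [Module.Projective S P'] (h : IsLocalModule S P)
    (h' : IsLocalModule S P') [Decidable (Nonempty (P ≃ₗ[S] P'))] :
    homLength (S := S) P (ModuleTop S P') = if Nonempty (P ≃ₗ[S] P') then 1 else 0 := by
  have := h'.isSimpleModule_top
  split_ifs with he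
  · obtain ⟨e⟩ := he
    refine homLength_eq_one P (f := (Module.jacobson S P').mkQ ∘ₗ e.toLinearMap) fun h0 => ?_
    have := h'.isSimpleModule_top.nontrivial
    obtain ⟨y, hy⟩ := exists_ne (0 : ModuleTop S P')
    obtain ⟨x, rfl⟩ := ((Module.jacobson S P').mkQ_surjective.comp e.surjective) y
    exact hy (LinearMap.congr_fun h0 x)
  · rw [homLength_eq_zero_iff]
    intro f
    by_contra hf
    obtain ⟨e⟩ := h.nonempty_top_equiv hf
    exact he (h.nonempty_equiv_of_top h' e)

end LocalModule

/-! ### Socles and isotypic components -/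

section Socle

variable {S : Type u} [Ring S] {M : Type v} [AddCommGroup M] [Module S M]

instance isSemisimpleModule_socle : IsSemisimpleModule S (socle S M) := by
  have := isSemisimpleModule_biSup_of_isSemisimpleModule_submodule
    (s := {N : Submodule S M | IsSimpleModule S N}) (p := id) fun N hN => by
      have : IsSimpleModule S N := hN
      exact inferInstanceAs (IsSemisimpleModule S N)
  rwa [socle, sSup_eq_iSup]

theorem le_socle_of_isSimpleModule (N : Submodule S M) [h : IsSimpleModule S N] :
    N ≤ socle S M := le_sSup h

theorem le_socle_of_isSemisimpleModule (N : Submodule S M) [IsSemisimpleModule S N] :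
    N ≤ socle S M := by
  have h := congrArg (Submodule.map N.subtype) (IsSemisimpleModule.sSup_simples_eq_top S N)
  rw [Submodule.map_top, Submodule.range_subtype, sSup_eq_iSup, Submodule.map_iSup] at h
  rw [← h]
  refine iSup_le fun K => ?_
  rw [Submodule.map_iSup]
  refine iSup_le fun hK => le_sSup ?_
  have : IsSimpleModule S K := hK
  exact IsSimpleModule.congr (Submodule.equivMapOfInjective N.subtype N.subtype_injective K).symm

theorem socle_map_subtype (N : Submodule S M) :
    (socle S N).map N.subtype = socle S M ⊓ N := by
  refine le_antisymm (le_inf ?_ (Submodule.map_subtype_le _ _)) fun x hx => ?_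
  · have : IsSemisimpleModule S ((socle S N).map N.subtype) :=
      IsSemisimpleModule.congr
        (Submodule.equivMapOfInjective N.subtype N.subtype_injective (socle S N)).symm
    exact le_socle_of_isSemisimpleModule _
  · have h1 : IsSemisimpleModule S (socle S M ⊓ N : Submodule S M) :=
      IsSemisimpleModule.of_injective (Submodule.inclusion inf_le_left)
        (Submodule.inclusion_injective _)
    have h2 : IsSemisimpleModule S ((socle S M).submoduleOf N) :=
      IsSemisimpleModule.of_injective
        ((N.subtype.comp (Submodule.subtype _)).codRestrict (socle S M ⊓ N : Submodule S M)
          fun y => ⟨y.2, y.1.2⟩) fun y z h => Subtype.ext (Subtype.ext (congrArg (fun w : ↥(socle S M ⊓ N : Submodule S M) => (w : M)) h))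
    exact ⟨⟨x, hx.2⟩, le_socle_of_isSemisimpleModule _ (show _ ∈ (socle S M).submoduleOf N from hx.1),
      rfl⟩

/-- The socle of a submodule is its intersection with the socle. -/
noncomputable def socleEquiv (N : Submodule S M) :
    socle S N ≃ₗ[S] (socle S M ⊓ N : Submodule S M) :=
  (Submodule.equivMapOfInjective N.subtype N.subtype_injective (socle S N)).trans
    (LinearEquiv.ofEq _ _ (socle_map_subtype N))

variable {V : Type*} [AddCommGroup V] [Module S V]
variable {P : Type*} [AddCommGroup P] [Module S P]

theorem isotypicComponent_le_socle [IsSimpleModule S V] : isotypicComponent S M V ≤ socle S M := by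
  refine sSup_le fun N ⟨e⟩ => ?_
  have := IsSimpleModule.congr e
  exact le_socle_of_isSimpleModule N

theorem range_le_isotypicComponent (hP : IsLocalModule S P) (e : ModuleTop S P ≃ₗ[S] V)
    (f : P →ₗ[S] M) (hf : ∀ x, f x ∈ socle S M) (x : P) : f x ∈ isotypicComponent S M V := by
  by_cases h0 : f = 0
  · rw [h0]; exact zero_mem _
  obtain ⟨e'⟩ := hP.nonempty_top_equiv_range (f := f.codRestrict _ hf) fun h => h0 (by
    ext x
    exact congrArg Subtype.val (LinearMap.congr_fun h x))
  have hle : LinearMap.range f ≤ isotypicComponent S M V := by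
    have h1 : LinearMap.range f =
        (LinearMap.range (f.codRestrict _ hf)).map (socle S M).subtype :=
      LinearMap.range_comp (f.codRestrict _ hf) (socle S M).subtype
    have e1 := Submodule.equivMapOfInjective (socle S M).subtype
      (Submodule.subtype_injective _) (LinearMap.range (f.codRestrict _ hf))
    exact le_sSup ⟨((LinearEquiv.ofEq _ _ h1).trans e1.symm).trans (e'.symm.trans e)⟩
  exact hle ⟨x, rfl⟩

/-- The image in the socle of a local module with top `V` is zero or a copy of `V`, so it already
lies in the component of `V`. -/
theorem homLength_isotypicComponent [IsSimpleModule S V] (hP : IsLocalModule S P) (e : ModuleTop S P ≃ₗ[S] V) :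
    homLength (S := S) P (isotypicComponent S M V) = homLength (S := S) P (socle S M) := by
  refine (LinearEquiv.ofBijective
    (homMap P (Submodule.inclusion isotypicComponent_le_socle)) ⟨homMap_injective P
      (Submodule.inclusion_injective _), fun f => ?_⟩).length_eq
  refine ⟨((socle S M).subtype ∘ₗ f).codRestrict _
    (range_le_isotypicComponent hP e _ fun x => (f x).2), ?_⟩
  ext x
  rfl

theorem homLength_isotypicComponent_eq_zero [IsSimpleModule S V] (hP : IsLocalModule S P)
    (he : ¬ Nonempty (ModuleTop S P ≃ₗ[S] V)) :
    homLength (S := S) P (isotypicComponent S M V) = 0 := by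
  have : IsSemisimpleModule S (isotypicComponent S M V) :=
    IsSemisimpleModule.of_injective (Submodule.inclusion isotypicComponent_le_socle)
      (Submodule.inclusion_injective _)
  rw [homLength_eq_zero_iff]
  intro f
  by_contra hf
  obtain ⟨e⟩ := hP.nonempty_top_equiv_range hf
  have := hP.isSimpleModule_top
  have := IsSimpleModule.congr e.symm
  obtain ⟨e'⟩ := IsIsotypicOfType.isotypicComponent S M V (LinearMap.range f)
  exact he ⟨e.trans e'⟩

/-- Isomorphic modules have isomorphic socles. -/
theorem nonempty_socle_equiv {N : Type*} [AddCommGroup N] [Module S N] (f : M ≃ₗ[S] N) :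
    Nonempty (socle S M ≃ₗ[S] socle S N) := by
  refine ⟨f.ofSubmodules _ _ (le_antisymm ?_ fun y hy => ?_)⟩
  · have : IsSemisimpleModule S ((socle S M).map f.toLinearMap) :=
      IsSemisimpleModule.congr (f.submoduleMap (socle S M)).symm
    exact le_socle_of_isSemisimpleModule _
  · have : IsSemisimpleModule S ((socle S N).map f.symm.toLinearMap) :=
      IsSemisimpleModule.congr (f.symm.submoduleMap (socle S N)).symm
    exact ⟨f.symm y, le_socle_of_isSemisimpleModule _ (Submodule.mem_map_of_mem hy),
      f.apply_symm_apply y⟩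

end Socle

/-! ### Peirce decompositions, treated symmetrically on the two sides -/

/-- A ring `A`, seen as a module over two rings `S` and `T` that act by left and by right
multiplication (in either order), together with a decomposition of its unit into
pairwise orthogonal local idempotents. The product of `a` and `b` is `s a • b = t b • a`.
The two sides are interchanged by `PeirceSystem.flip`. -/
structure PeirceSystem (S T A : Type u) (ι : Type) [Ring S] [Ring T] [AddCommGroup A]
    [Module S A] [Module T A] [Fintype ι] where
  /-- An element of `A` as a scalar in `S`. -/
  s : A ≃ₗ[S] S
  /-- An element of `A` as a scalar in `T`. -/
  t : A ≃ₗ[T] T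
  s_smul : ∀ a b, s a • b = t b • a
  /-- The idempotents. -/
  e : ι → A
  idem : ∀ i, s (e i) • e i = e i
  ortho : ∀ i j, i ≠ j → s (e i) • e j = 0
  s_sum : s (∑ i, e i) = 1
  t_sum : t (∑ i, e i) = 1
  e_ne_zero : ∀ i, e i ≠ 0
  isLocal : ∀ i x y, s (e i) • x = x → t (e i) • x = x → s (e i) • y = y → t (e i) • y = y →
    x + y = e i →
      (∃ z, s z • x = e i ∧ t z • x = e i) ∨ (∃ z, s z • y = e i ∧ t z • y = e i)

namespace PeirceSystem

variable {S T A : Type u} {ι : Type} [Ring S] [Ring T] [AddCommGroup A]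
    [Module S A] [Module T A] [Fintype ι] (E : PeirceSystem S T A ι)

/-- Interchange of the two sides. -/
def flip : PeirceSystem T S A ι where
  s := E.t
  t := E.s
  s_smul a b := (E.s_smul b a).symm
  e := E.e
  idem i := (E.s_smul _ _).symm.trans (E.idem i)
  ortho i j h := (E.s_smul _ _).symm.trans (E.ortho j i h.symm)
  s_sum := E.t_sum
  t_sum := E.s_sum
  e_ne_zero := E.e_ne_zero
  isLocal i x y h1 h2 h3 h4 h := (E.isLocal i x y h2 h1 h4 h3 h).imp
    (fun ⟨z, h⟩ => ⟨z, h.2, h.1⟩) (fun ⟨z, h⟩ => ⟨z, h.2, h.1⟩)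

@[simp] theorem flip_e (i : ι) : E.flip.e i = E.e i := rfl

include E in
theorem smul_comm (r : S) (q : T) (x : A) : q • r • x = r • q • x := by
  obtain ⟨b, rfl⟩ := E.t.surjective q
  rw [← E.s_smul, map_smul, smul_assoc, E.s_smul]

theorem sum_t_smul (x : A) : ∑ i, E.t (E.e i) • x = x := by
  rw [← Finset.sum_smul, ← map_sum, E.t_sum, one_smul]

theorem sum_s_smul {M : Type*} [AddCommGroup M] [Module S M] (x : M) :
    ∑ i, E.s (E.e i) • x = x := by
  rw [← Finset.sum_smul, ← map_sum, E.s_sum, one_smul]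

/-- Multiplication by `b` on the other side. -/
def mulHom (b : A) : A →ₗ[S] A where
  toFun x := E.t b • x
  map_add' := smul_add _
  map_smul' r x := E.smul_comm r _ x

@[simp] theorem mulHom_apply (b x : A) : E.mulHom b x = E.t b • x := rfl

/-- The linear map given by multiplication with an element of a module. -/
def toHom {M : Type*} [AddCommGroup M] [Module S M] (m : M) : A →ₗ[S] M where
  toFun x := E.s x • m
  map_add' x y := by rw [map_add, add_smul]
  map_smul' r x := by rw [map_smul, smul_assoc, RingHom.id_apply]

/-- The principal ideal generated by an idempotent. -/
abbrev ideal (i : ι) : Submodule S A := Submodule.span S {E.e i}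

theorem t_smul_e (i : ι) : E.t (E.e i) • E.e i = E.e i := E.flip.idem i

theorem e_mem (i : ι) : E.e i ∈ E.ideal i := Submodule.mem_span_singleton_self _

theorem mem_ideal {i : ι} {x : A} : x ∈ E.ideal i ↔ E.t (E.e i) • x = x := by
  constructor
  · intro h
    obtain ⟨r, rfl⟩ := Submodule.mem_span_singleton.1 h
    rw [E.smul_comm, E.t_smul_e]
  · intro h
    rw [← h, ← E.s_smul]
    exact Submodule.smul_mem _ _ (E.e_mem i)

theorem t_smul_t_smul (i j : ι) [Decidable (i = j)] (x : A) :
    E.t (E.e i) • E.t (E.e j) • x = if i = j then E.t (E.e i) • x else 0 := by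
  split_ifs with h
  · subst h
    exact E.mem_ideal.1 (by rw [← E.s_smul]; exact Submodule.smul_mem _ _ (E.e_mem i))
  · have h0 : E.t (E.e i) • E.e j = 0 := E.flip.ortho i j h
    rw [← E.s_smul x, E.smul_comm, h0, smul_zero]

/-- The projection onto a principal ideal. -/
def proj (i : ι) : A →ₗ[S] E.ideal i :=
  (E.mulHom (E.e i)).codRestrict _ fun x => by
    rw [mulHom_apply, ← E.s_smul]; exact Submodule.smul_mem _ _ (E.e_mem i)

@[simp] theorem coe_proj (i : ι) (x : A) : (E.proj i x : A) = E.t (E.e i) • x := rfl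

theorem proj_coe {i : ι} (x : E.ideal i) : E.proj i x = x := Subtype.ext (E.mem_ideal.1 x.2)

instance projective_ideal (i : ι) : Module.Projective S (E.ideal i) := by
  have : Module.Projective S A := Module.Projective.of_equiv E.s.symm
  exact Module.Projective.of_split (E.ideal i).subtype (E.proj i)
    (LinearMap.ext fun x => E.proj_coe x)

/-- If `e_i = x + y` with `x ∈ U` and `y ∈ W`, then `e_i x` and `e_i y` lie in the local ring `e_i A
e_i` and have sum `e_i`. One of them is invertible there, and its submodule contains `e_i`. -/
theorem isLocalModule_ideal (i : ι) : IsLocalModule S (E.ideal i) where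
  nontrivial := ⟨⟨⟨E.e i, E.e_mem i⟩, 0, fun h => E.e_ne_zero i (congrArg Subtype.val h)⟩⟩
  finite := Module.Finite.span_singleton S (E.e i)
  eq_top_or U W h := by
    have key : ∀ U : Submodule S (E.ideal i), ∀ x ∈ U,
        (∃ z, E.s z • E.s (E.e i) • (x : A) = E.e i) → U = ⊤ := by
      rintro U x hx ⟨z, hz⟩
      rw [eq_top_iff]
      rintro ⟨y, hy⟩ -
      obtain ⟨r, rfl⟩ := Submodule.mem_span_singleton.1 hy
      have := U.smul_mem r (U.smul_mem (E.s z) (U.smul_mem (E.s (E.e i)) hx))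
      have h : (⟨r • E.e i, hy⟩ : E.ideal i) = r • E.s z • E.s (E.e i) • x :=
        Subtype.ext (congrArg (r • ·) hz.symm)
      rwa [h]
    obtain ⟨x, hx, y, hy, hxy⟩ := Submodule.mem_sup.1
      (show (⟨E.e i, E.e_mem i⟩ : E.ideal i) ∈ U ⊔ W from h ▸ Submodule.mem_top)
    have hxy' : (x : A) + y = E.e i := congrArg Subtype.val hxy
    have hs : ∀ x : A, E.s (E.e i) • E.s (E.e i) • x = E.s (E.e i) • x := fun x => by
      rw [← smul_assoc, ← map_smul, E.idem]
    have ht : ∀ x : E.ideal i, E.t (E.e i) • E.s (E.e i) • (x : A) = E.s (E.e i) • (x : A) :=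
      fun x => by rw [E.smul_comm, E.mem_ideal.1 x.2]
    rcases E.isLocal i (E.s (E.e i) • (x : A)) (E.s (E.e i) • (y : A)) (hs _) (ht _) (hs _)
      (ht _) (by rw [← smul_add, hxy', E.idem]) with ⟨z, hz, -⟩ | ⟨z, hz, -⟩
    · exact Or.inl (key U x hx ⟨z, hz⟩)
    · exact Or.inr (key W y hy ⟨z, hz⟩)

/-- This is the identification of `Hom(A e_i, M)` with `e_i M`, by evaluation at `e_i`. -/
theorem homLength_ideal_ne_zero {i : ι} {M : Type*} [AddCommGroup M] [Module S M] :
    homLength (S := S) (E.ideal i) M ≠ 0 ↔ ∃ m : M, E.s (E.e i) • m ≠ 0 := by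
  rw [Ne, homLength_eq_zero_iff]
  constructor
  · intro h
    by_contra! h'
    refine h fun f => ?_
    ext ⟨x, hx⟩
    obtain ⟨r, rfl⟩ := Submodule.mem_span_singleton.1 hx
    have h1 := h' (f ⟨E.e i, E.e_mem i⟩)
    rw [← map_smul] at h1
    have h2 : E.s (E.e i) • (⟨E.e i, E.e_mem i⟩ : E.ideal i) = ⟨E.e i, E.e_mem i⟩ :=
      Subtype.ext (E.idem i)
    rw [h2] at h1
    have h3 : (⟨r • E.e i, hx⟩ : E.ideal i) = r • ⟨E.e i, E.e_mem i⟩ := rfl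
    rw [h3, map_smul, h1, smul_zero, LinearMap.zero_apply]
  · rintro ⟨m, hm⟩ h
    exact hm (LinearMap.congr_fun (h (E.toHom m ∘ₗ (E.ideal i).subtype)) ⟨E.e i, E.e_mem i⟩)

theorem exists_homLength_ne_zero (M : Type*) [AddCommGroup M] [Module S M] [Nontrivial M] :
    ∃ i, homLength (S := S) (E.ideal i) M ≠ 0 := by
  obtain ⟨m, hm⟩ := exists_ne (0 : M)
  by_contra! h
  refine hm ?_
  rw [← E.sum_s_smul m]
  refine Finset.sum_eq_zero fun i _ => ?_
  by_contra hi
  exact E.homLength_ideal_ne_zero.2 ⟨m, hi⟩ (h i)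

/-! ### Isomorphism of idempotents -/

/-- Isomorphism of idempotents; it amounts to isomorphism of the principal ideals on either
side. -/
def Iso (i j : ι) : Prop := ∃ u v, E.s u • v = E.e i ∧ E.s v • u = E.e j

theorem iso_flip {i j : ι} : E.flip.Iso i j ↔ E.Iso i j := by
  constructor <;> rintro ⟨u, v, h1, h2⟩
  · exact ⟨v, u, (E.s_smul _ _).trans h1, (E.s_smul _ _).trans h2⟩
  · exact ⟨v, u, (E.s_smul _ _).symm.trans h1, (E.s_smul _ _).symm.trans h2⟩

/-- Right multiplication by `u` and `v` gives mutually inverse maps; conversely `u` and `v` are the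
images of the idempotents. Since `Iso` is symmetric in the two sides (`iso_flip`), left and right
principal ideals have the same isomorphism classes. -/
theorem iso_iff {i j : ι} : E.Iso i j ↔ Nonempty (E.ideal i ≃ₗ[S] E.ideal j) := by
  constructor
  · have key : ∀ {i j u v}, E.s u • v = E.e i → E.s v • u = E.e j → ∀ x ∈ E.ideal i,
        E.t u • x ∈ E.ideal j ∧ E.t v • E.t u • x = x := by
      intro i j u v h1 h2 x hx
      have h3 : ∀ x : A, E.t v • E.t u • x = E.t (E.e i) • x := fun x => by
        rw [← h1, E.s_smul, map_smul, smul_eq_mul, mul_smul]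
      refine ⟨E.mem_ideal.2 ?_, (h3 x).trans (E.mem_ideal.1 hx)⟩
      rw [← h2, E.s_smul, map_smul, smul_eq_mul, mul_smul, h3, E.mem_ideal.1 hx]
    rintro ⟨u, v, h1, h2⟩
    exact ⟨
      { toFun x := ⟨E.t u • x, (key h1 h2 x x.2).1⟩
        map_add' x y := Subtype.ext (smul_add _ _ _)
        map_smul' r x := Subtype.ext (E.smul_comm r _ _)
        invFun x := ⟨E.t v • x, (key h2 h1 x x.2).1⟩
        left_inv x := Subtype.ext (key h1 h2 x x.2).2
        right_inv x := Subtype.ext (key h2 h1 x x.2).2 }⟩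
  · have key : ∀ {i j} (f : E.ideal i ≃ₗ[S] E.ideal j),
        E.s (f ⟨E.e i, E.e_mem i⟩ : A) • (f.symm ⟨E.e j, E.e_mem j⟩ : A) = E.e i := by
      intro i j f
      set u := f ⟨E.e i, E.e_mem i⟩ with hu
      have h : E.s (u : A) • (⟨E.e j, E.e_mem j⟩ : E.ideal j) = u :=
        Subtype.ext ((E.s_smul _ _).trans (E.mem_ideal.1 u.2))
      have := congrArg (fun z => (f.symm z : A)) h
      rw [map_smul, LinearEquiv.symm_apply_apply] at this
      exact this
    rintro ⟨f⟩
    refine ⟨_, _, key f, ?_⟩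
    simpa using key f.symm

theorem Iso.refl (i : ι) : E.Iso i i := E.iso_iff.2 ⟨LinearEquiv.refl _ _⟩

variable {E} in
theorem Iso.symm {i j : ι} (h : E.Iso i j) : E.Iso j i :=
  E.iso_iff.2 ((E.iso_iff.1 h).map LinearEquiv.symm)

variable {E} in
theorem Iso.trans {i j k : ι} (h : E.Iso i j) (h' : E.Iso j k) : E.Iso i k := by
  obtain ⟨f⟩ := E.iso_iff.1 h
  obtain ⟨g⟩ := E.iso_iff.1 h'
  exact E.iso_iff.2 ⟨f.trans g⟩

open Classical in
/-- The number of idempotents isomorphic to a given one. -/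
noncomputable def multiplicity (i : ι) : ℕ := (Finset.univ.filter fun j => E.Iso j i).card

theorem multiplicity_flip (i : ι) : E.flip.multiplicity i = E.multiplicity i := by
  unfold multiplicity
  congr 1
  ext k
  simp only [Finset.mem_filter, E.iso_flip]

theorem multiplicity_pos (i : ι) : 0 < E.multiplicity i :=
  Finset.card_pos.2 ⟨i, by simpa using Iso.refl E i⟩

variable {E} in
theorem Iso.multiplicity_eq {i j : ι} (h : E.Iso i j) : E.multiplicity i = E.multiplicity j := by
  unfold multiplicity
  congr 1
  ext k
  simp only [Finset.mem_filter, Finset.mem_univ, true_and]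
  exact ⟨fun hk => hk.trans h, fun hk => hk.trans h.symm⟩

/-- The simple module on top of a principal ideal. -/
abbrev Top (i : ι) : Type u := ModuleTop S (E.ideal i)

instance isSimpleModule_top (i : ι) : IsSimpleModule S (E.Top i) :=
  (E.isLocalModule_ideal i).isSimpleModule_top

open Classical in
theorem homLength_ideal_top (i j : ι) :
    homLength (S := S) (E.ideal i) (E.Top j) = if E.Iso i j then 1 else 0 := by
  rw [homLength_top (E.isLocalModule_ideal i) (E.isLocalModule_ideal j)]
  simp only [E.iso_iff]

theorem iso_of_top_equiv {i j : ι} (f : E.Top i ≃ₗ[S] E.Top j) : E.Iso i j :=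
  E.iso_iff.2 ((E.isLocalModule_ideal i).nonempty_equiv_of_top (E.isLocalModule_ideal j) f)

theorem Iso.nonempty_top_equiv {i j : ι} (h : E.Iso i j) :
    Nonempty (E.Top i ≃ₗ[S] E.Top j) := by
  classical
  have hf : ¬ ∀ f : E.ideal i →ₗ[S] E.Top j, f = 0 := by
    rw [← homLength_eq_zero_iff, homLength_ideal_top, if_pos h]
    exact one_ne_zero
  push Not at hf
  obtain ⟨f, hf⟩ := hf
  exact (E.isLocalModule_ideal i).nonempty_top_equiv hf

/-! ### The generalised dimension as a sum over all idempotents -/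

section Dim

variable {M N : Type*} [AddCommGroup M] [Module S M] [AddCommGroup N] [Module S N]

/-- The generalised dimension, as the sum over all idempotents of the lengths of the modules
of homomorphisms from the principal ideals. -/
noncomputable def dim (M : Type*) [AddCommGroup M] [Module S M] : ℕ∞ :=
  ∑ i, homLength (S := S) (E.ideal i) M

theorem dim_congr (f : M ≃ₗ[S] N) : E.dim M = E.dim N :=
  Finset.sum_congr rfl fun _ _ => homLength_congr _ f

theorem dim_le_of_injective (f : M →ₗ[S] N) (hf : Function.Injective f) : E.dim M ≤ E.dim N :=
  Finset.sum_le_sum fun _ _ => homLength_le_of_injective _ f hf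

theorem dim_le_of_surjective (f : M →ₗ[S] N) (hf : Function.Surjective f) : E.dim N ≤ E.dim M :=
  Finset.sum_le_sum fun _ _ => homLength_le_of_surjective _ f hf

theorem dim_eq_add_quotient (K : Submodule S M) : E.dim M = E.dim K + E.dim (M ⧸ K) := by
  unfold dim
  rw [← Finset.sum_add_distrib]
  exact Finset.sum_congr rfl fun _ _ => homLength_eq_add_quotient _ K

theorem dim_pi {κ : Type*} [Fintype κ] (M : κ → Type*) [∀ i, AddCommGroup (M i)]
    [∀ i, Module S (M i)] : E.dim (∀ i, M i) = ∑ i, E.dim (M i) := by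
  unfold dim
  rw [Finset.sum_comm]
  exact Finset.sum_congr rfl fun _ _ => homLength_pi _ _

theorem dim_eq_zero_iff : E.dim M = 0 ↔ Subsingleton M := by
  constructor
  · intro h
    by_contra hM
    rw [not_subsingleton_iff_nontrivial] at hM
    obtain ⟨i, hi⟩ := E.exists_homLength_ne_zero M
    exact hi ((Finset.sum_eq_zero_iff).1 h i (Finset.mem_univ i))
  · intro h
    refine Finset.sum_eq_zero fun i _ => (homLength_eq_zero_iff _).2 fun f => ?_
    ext
    exact Subsingleton.elim _ _

theorem dim_top (i : ι) : E.dim (E.Top i) = E.multiplicity i := by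
  classical
  unfold dim multiplicity
  simp only [homLength_ideal_top, Finset.sum_boole]

theorem surjective_of_dim_le (f : N →ₗ[S] M) (hf : Function.Injective f)
    (h : E.dim M ≤ E.dim N) (hfin : E.dim N ≠ ⊤) : Function.Surjective f := by
  rw [← LinearMap.range_eq_top, ← Submodule.Quotient.subsingleton_iff, ← E.dim_eq_zero_iff]
  rw [E.dim_eq_add_quotient (LinearMap.range f), ← E.dim_congr (LinearEquiv.ofInjective f hf)] at h
  generalize E.dim N = a at *
  generalize E.dim (M ⧸ LinearMap.range f) = b at *
  cases a with
  | top => exact absurd rfl hfin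
  | coe a =>
    cases b with
    | top => simp at h
    | coe b => norm_cast at h ⊢; omega

theorem injective_of_dim_le (f : M →ₗ[S] N) (hf : Function.Surjective f)
    (h : E.dim M ≤ E.dim N) (hfin : E.dim N ≠ ⊤) : Function.Injective f := by
  rw [← LinearMap.ker_eq_bot, ← Submodule.subsingleton_iff_eq_bot, ← E.dim_eq_zero_iff]
  rw [E.dim_eq_add_quotient (LinearMap.ker f),
    E.dim_congr (f.quotKerEquivOfSurjective hf)] at h
  generalize E.dim N = a at *
  generalize E.dim (LinearMap.ker f) = b at *
  cases a with
  | top => exact absurd rfl hfin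
  | coe a =>
    cases b with
    | top => simp at h
    | coe b => norm_cast at h ⊢; omega

theorem exists_top_equiv (V : Type*) [AddCommGroup V] [Module S V] [IsSimpleModule S V] :
    ∃ i, Nonempty (E.Top i ≃ₗ[S] V) := by
  have := IsSimpleModule.nontrivial S V
  obtain ⟨i, hi⟩ := E.exists_homLength_ne_zero V
  rw [Ne, homLength_eq_zero_iff] at hi
  push Not at hi
  obtain ⟨f, hf⟩ := hi
  exact ⟨i, (E.isLocalModule_ideal i).nonempty_top_equiv hf⟩

/-- A finite `dim` is strictly monotone on submodules and bounded by `dim M`, which yields both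
chain conditions. -/
theorem isFiniteLength_of_dim_ne_top (h : E.dim M ≠ ⊤) : IsFiniteLength S M := by
  have hK : ∀ K : Submodule S M, E.dim K ≠ ⊤ := fun K =>
    ne_top_of_le_ne_top h (E.dim_le_of_injective K.subtype K.subtype_injective)
  have hmono : StrictMono fun K : Submodule S M => E.dim K := by
    intro K L hKL
    refine lt_of_le_of_ne (E.dim_le_of_injective (Submodule.inclusion hKL.le)
      (Submodule.inclusion_injective _)) fun heq => hKL.not_ge fun x hx => ?_
    obtain ⟨y, hy⟩ := E.surjective_of_dim_le (Submodule.inclusion hKL.le)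
      (Submodule.inclusion_injective _) heq.ge (hK K) ⟨x, hx⟩
    have := congrArg Subtype.val hy
    exact (show (y : M) = x from this) ▸ y.2
  have hlt : WellFoundedLT (Submodule S M) := hmono.wellFoundedLT
  have hgt : WellFoundedGT (Submodule S M) := by
    obtain ⟨n, hn⟩ := ENat.ne_top_iff_exists.1 h
    choose g hg using fun K => ENat.ne_top_iff_exists.1 (hK K)
    have hle : ∀ K, g K ≤ n := fun K => by
      have := E.dim_le_of_injective K.subtype K.subtype_injective
      rw [← hg, ← hn] at this
      exact_mod_cast this
    have hanti : StrictAnti fun K : Submodule S M => n - g K := by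
      intro K L hKL
      have : E.dim K < E.dim L := hmono hKL
      rw [← hg, ← hg] at this
      have h1 : g K < g L := by exact_mod_cast this
      have h2 := hle L
      change n - g L < n - g K
      omega
    exact hanti.wellFoundedGT
  exact isFiniteLength_iff_isNoetherian_isArtinian.2
    ⟨isNoetherian_iff'.2 hgt, hlt⟩

theorem eq_sum_of_succ {B : Type*} [AddCommMonoid B] : ∀ (n : ℕ) (f : Fin (n + 1) → B)
    (g : Fin n → B), f 0 = 0 → (∀ i : Fin n, f i.succ = f i.castSucc + g i) →
      f (Fin.last n) = ∑ i, g i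
  | 0, f, g, h0, _ => by simpa using h0
  | n + 1, f, g, h0, h => by
    rw [Fin.sum_univ_castSucc, ← eq_sum_of_succ n (fun i => f i.castSucc) (fun i => g i.castSucc)
      h0 fun i => h i.castSucc]
    exact h (Fin.last n)

theorem dim_eq_of_hasLength {κ : Type} (rep : κ → ι) {d : ℕ}
    (h : HasLength S M (fun k => E.Top (rep k)) (fun k => E.multiplicity (rep k)) d) :
    E.dim M = d := by
  obtain ⟨s, h0, h1, c, hc, rfl⟩ := h
  have hlast := eq_sum_of_succ s.length (fun i => E.dim (s i))
    (fun i => (E.multiplicity (rep (c i)) : ℕ∞)) ?_ fun i => ?_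
  · have h1' : s (Fin.last s.length) = ⊤ := h1
    rw [h1', E.dim_congr Submodule.topEquiv] at hlast
    rw [hlast]
    push_cast
    rfl
  · have h0' : s 0 = ⊥ := h0
    change E.dim (s 0) = 0
    rw [h0', E.dim_eq_zero_iff]
    infer_instance
  · obtain ⟨f⟩ := hc i
    change E.dim (s i.succ) = E.dim (s i.castSucc) + _
    rw [E.dim_eq_add_quotient ((s i.castSucc).submoduleOf (s i.succ)), E.dim_congr f, E.dim_top,
      E.dim_congr (Submodule.submoduleOfEquivOfLe (s.step i).le)]

/-- This replaces composition series by the additive function `dim`. For the converse, a finite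
`dim` provides a composition series, and every simple factor is the top of some representative. -/
theorem hasLength_iff {κ : Type} (rep : κ → ι) (hrep : ∀ i, ∃ k, E.Iso i (rep k)) {d : ℕ} :
    HasLength S M (fun k => E.Top (rep k)) (fun k => E.multiplicity (rep k)) d ↔
      E.dim M = d := by
  refine ⟨E.dim_eq_of_hasLength rep, fun h => ?_⟩
  obtain ⟨s, h0, h1⟩ := isFiniteLength_iff_exists_compositionSeries.1
    (E.isFiniteLength_of_dim_ne_top (M := M) (by rw [h]; exact ENat.natCast_ne_top _))
  have hex : ∀ i : Fin s.length, ∃ k, Nonempty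
      ((↥(s i.succ) ⧸ (s i.castSucc).submoduleOf (s i.succ)) ≃ₗ[S] E.Top (rep k)) := by
    intro i
    have : IsSimpleModule S (↥(s i.succ) ⧸ (s i.castSucc).submoduleOf (s i.succ)) :=
      (covBy_iff_quot_is_simple (s.step i).le).1 (s.step i)
    obtain ⟨j, ⟨f⟩⟩ := E.exists_top_equiv (↥(s i.succ) ⧸ (s i.castSucc).submoduleOf (s i.succ))
    obtain ⟨k, hk⟩ := hrep j
    obtain ⟨g⟩ := hk.nonempty_top_equiv
    exact ⟨k, ⟨f.symm.trans g⟩⟩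
  choose c hc using hex
  refine ⟨s, h0, h1, c, hc, ?_⟩
  have := E.dim_eq_of_hasLength rep ⟨s, h0, h1, c, hc, rfl⟩
  rw [h] at this
  exact_mod_cast this.symm

/-- The isomorphism classes of idempotents. -/
def isoSetoid : Setoid ι := ⟨E.Iso, Iso.refl E, Iso.symm, Iso.trans⟩

theorem exists_equiv_pi_top [IsSemisimpleModule S M] (h : E.dim M ≠ ⊤) :
    ∃ (n : ℕ) (c : Fin n → ι), Nonempty (M ≃ₗ[S] ∀ j, E.Top (c j)) := by
  have := (isFiniteLength_iff_isNoetherian_isArtinian.1 (E.isFiniteLength_of_dim_ne_top h)).1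
  obtain ⟨n, V, f, hV⟩ := IsSemisimpleModule.exists_linearEquiv_fin_dfinsupp S M
  choose c hc using fun j => E.exists_top_equiv (V j)
  exact ⟨n, c, ⟨f.trans ((DFinsupp.linearEquivFunOnFintype (R := S)).trans
    (LinearEquiv.piCongrRight fun j => (hc j).some.symm))⟩⟩

theorem nonempty_equiv_of_homLength_eq [IsSemisimpleModule S M] [IsSemisimpleModule S N]
    (h : ∀ i, homLength (S := S) (E.ideal i) M = homLength (S := S) (E.ideal i) N)
    (hfin : E.dim M ≠ ⊤) : Nonempty (M ≃ₗ[S] N) := by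
  classical
  have hfin' : E.dim N ≠ ⊤ := by
    rw [dim, ← Finset.sum_congr rfl fun i _ => h i]; exact hfin
  obtain ⟨n, c, ⟨f⟩⟩ := E.exists_equiv_pi_top hfin
  obtain ⟨n', c', ⟨f'⟩⟩ := E.exists_equiv_pi_top hfin'
  have hcard : ∀ i, (Finset.univ.filter fun j => E.Iso i (c j)).card =
      (Finset.univ.filter fun j => E.Iso i (c' j)).card := by
    intro i
    have := h i
    rw [homLength_congr _ f, homLength_congr _ f', homLength_pi, homLength_pi] at this
    simp only [homLength_ideal_top, Finset.sum_boole] at this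
    exact_mod_cast this
  -- Both modules are finite products of tops. Equal multiplicities mean fibres of equal size over
  -- each isomorphism class, hence a bijection `σ` between the factors.
  let q : ι → Quotient E.isoSetoid := Quotient.mk _
  have hq : ∀ {i j}, q i = q j ↔ E.Iso i j := Quotient.eq
  have hfib : ∀ x : Quotient E.isoSetoid,
      Nonempty ({j // q (c j) = x} ≃ {j // q (c' j) = x}) := by
    intro x
    obtain ⟨i, rfl⟩ := Quotient.exists_rep x
    refine Fintype.card_eq.1 ?_
    rw [Fintype.card_subtype, Fintype.card_subtype]
    convert hcard i using 3 <;>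
    · exact hq.trans ⟨Iso.symm, Iso.symm⟩
  let σ : Fin n ≃ Fin n' := Equiv.ofFiberEquiv (f := fun j => q (c j)) (g := fun j => q (c' j))
    fun x => (hfib x).some
  have hσ : ∀ j, E.Iso (c j) (c' (σ j)) := fun j =>
    (hq.1 (Equiv.ofFiberEquiv_map (f := fun j => q (c j)) (g := fun j => q (c' j))
      (fun x => (hfib x).some) j)).symm
  exact ⟨(f.trans (LinearEquiv.piCongrRight fun j => (hσ j).nonempty_top_equiv.some)).trans
    ((LinearEquiv.piCongrLeft S (fun j => E.Top (c' j)) σ).trans f'.symm)⟩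

end Dim

/-! ### Decompositions of two-sided ideals and of their quotients -/

section TwoSided

/-- The decomposition of a two-sided ideal into one-sided ideals. -/
def decompose (N : Submodule S A) (hN : ∀ x ∈ N, ∀ q : T, q • x ∈ N) :
    N ≃ₗ[S] ∀ j, ↥(N ⊓ E.ideal j) where
  toFun x j := ⟨E.t (E.e j) • x, hN x x.2 _, (E.proj j x).2⟩
  map_add' x y := funext fun j => Subtype.ext (smul_add _ _ _)
  map_smul' r x := funext fun j => Subtype.ext (E.smul_comm r _ _)
  invFun y := ⟨∑ j, (y j : A), sum_mem fun j _ => (y j).2.1⟩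
  left_inv x := Subtype.ext (E.sum_t_smul x)
  right_inv y := by
    classical
    funext j
    refine Subtype.ext ?_
    change E.t (E.e j) • ∑ k, (y k : A) = y j
    rw [Finset.smul_sum]
    have : ∀ k, E.t (E.e j) • (y k : A) = if j = k then (y k : A) else 0 := fun k => by
      rw [← E.mem_ideal.1 (y k).2.2, E.t_smul_t_smul]
      split_ifs with h
      · rw [h]
      · rfl
    simp only [this, Finset.sum_ite_eq, Finset.mem_univ, if_true]

variable {I : Submodule S A} (hI : ∀ x ∈ I, ∀ q : T, q • x ∈ I)
  (hJ : ∀ j, ∀ x ∈ Module.jacobson S (E.ideal j), (x : A) ∈ I)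

include hI in
theorem nonempty_quotient_equiv_pi :
    Nonempty ((A ⧸ I) ≃ₗ[S] ∀ j, E.ideal j ⧸ I.submoduleOf (E.ideal j)) := by
  classical
  let f : A →ₗ[S] ∀ j, E.ideal j ⧸ I.submoduleOf (E.ideal j) :=
    LinearMap.pi fun j => (I.submoduleOf (E.ideal j)).mkQ ∘ₗ E.proj j
  have hf : ∀ x, f x = 0 ↔ ∀ j, E.t (E.e j) • x ∈ I := fun x => by
    rw [funext_iff]
    exact forall_congr' fun j => Submodule.Quotient.mk_eq_zero _
  have hker : LinearMap.ker f = I := by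
    ext x
    rw [LinearMap.mem_ker, hf]
    refine ⟨fun h => ?_, fun h j => hI x h _⟩
    rw [← E.sum_t_smul x]
    exact sum_mem fun j _ => h j
  refine ⟨(Submodule.quotEquivOfEq _ _ hker.symm).trans (f.quotKerEquivOfSurjective fun y => ?_)⟩
  choose x hx using fun j => (I.submoduleOf (E.ideal j)).mkQ_surjective (y j)
  refine ⟨∑ k, (x k : A), funext fun j => ?_⟩
  rw [← hx j]
  refine congrArg (I.submoduleOf (E.ideal j)).mkQ (Subtype.ext ?_)
  rw [coe_proj, Finset.smul_sum]
  have : ∀ k, E.t (E.e j) • (x k : A) = if j = k then (x k : A) else 0 := fun k => by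
    rw [← E.mem_ideal.1 (x k).2, E.t_smul_t_smul]
    split_ifs with h
    · rw [h]
    · rfl
  simp only [this, Finset.sum_ite_eq, Finset.mem_univ, if_true]

include hJ in
theorem submoduleOf_eq_jacobson {j : ι} (hj : E.e j ∉ I) :
    I.submoduleOf (E.ideal j) = Module.jacobson S (E.ideal j) := by
  refine (((E.isLocalModule_ideal j).isCoatom_jacobson.le_iff).1 (hJ j)).resolve_left fun h => ?_
  have : (⟨E.e j, E.e_mem j⟩ : E.ideal j) ∈ I.submoduleOf (E.ideal j) := h ▸ Submodule.mem_top
  exact hj this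

theorem submoduleOf_eq_top {j : ι} (hj : E.e j ∈ I) : I.submoduleOf (E.ideal j) = ⊤ :=
  Submodule.submoduleOf_eq_top.2 ((Submodule.span_singleton_le_iff_mem _ _).2 hj)

-- `A/I` is the product of the `A e_j / (I ∩ A e_j)`. Since `I ∩ A e_j` contains the unique maximal
-- submodule of `A e_j`, each factor is either zero (when `e_j ∈ I`) or the top of `A e_j`.
open Classical in
include hI hJ in
theorem homLength_ideal_quotient (i : ι) : homLength (S := S) (E.ideal i) (A ⧸ I) =
    ∑ j, if E.e j ∈ I then 0 else if E.Iso i j then 1 else 0 := by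
  obtain ⟨f⟩ := E.nonempty_quotient_equiv_pi hI
  rw [homLength_congr _ f, homLength_pi]
  refine Finset.sum_congr rfl fun j _ => ?_
  split_ifs with hj hij
  · rw [homLength_eq_zero_iff]
    have := Submodule.Quotient.subsingleton_iff.2 (E.submoduleOf_eq_top hj)
    exact fun g => LinearMap.ext fun x => Subsingleton.elim _ _
  · rw [homLength_congr _ (Submodule.quotEquivOfEq _ _ (E.submoduleOf_eq_jacobson hJ hj)),
      E.homLength_ideal_top, if_pos hij]
  · rw [homLength_congr _ (Submodule.quotEquivOfEq _ _ (E.submoduleOf_eq_jacobson hJ hj)),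
      E.homLength_ideal_top, if_neg hij]

open Classical in
include hI hJ in
theorem dim_quotient : E.dim (A ⧸ I) =
    ∑ j, if E.e j ∈ I then 0 else (E.multiplicity j : ℕ∞) := by
  unfold dim
  simp only [E.homLength_ideal_quotient hI hJ]
  rw [Finset.sum_comm]
  refine Finset.sum_congr rfl fun j _ => ?_
  split_ifs
  · simp
  · rw [Finset.sum_boole]; rfl

include E in
theorem jacobson_twoSided (x : A) (hx : x ∈ Module.jacobson S A) (q : T) :
    q • x ∈ Module.jacobson S A := by
  obtain ⟨b, rfl⟩ := E.t.surjective q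
  exact Module.map_jacobson_le (E.mulHom b) (Submodule.mem_map_of_mem hx)

theorem mem_jacobson_of_mem_jacobson_ideal (j : ι) (x : E.ideal j)
    (hx : x ∈ Module.jacobson S (E.ideal j)) : (x : A) ∈ Module.jacobson S A :=
  Module.map_jacobson_le (E.ideal j).subtype (Submodule.mem_map_of_mem hx)

theorem e_notMem_jacobson (j : ι) : E.e j ∉ Module.jacobson S A := fun h => by
  have h1 := Module.map_jacobson_le (E.proj j) (Submodule.mem_map_of_mem h)
  rw [show E.proj j (E.e j) = ⟨E.e j, E.e_mem j⟩ from Subtype.ext (E.t_smul_e j)] at h1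
  refine (E.isLocalModule_ideal j).isCoatom_jacobson.1 (eq_top_iff.2 ?_)
  rintro ⟨y, hy⟩ -
  obtain ⟨r, rfl⟩ := Submodule.mem_span_singleton.1 hy
  exact Submodule.smul_mem _ r h1

theorem homLength_ideal_moduleTop (i : ι) :
    homLength (S := S) (E.ideal i) (ModuleTop S A) = E.multiplicity i := by
  classical
  rw [E.homLength_ideal_quotient E.jacobson_twoSided
    E.mem_jacobson_of_mem_jacobson_ideal]
  simp only [e_notMem_jacobson, if_false, Finset.sum_boole, multiplicity]
  congr 2
  ext j
  simp only [Finset.mem_filter, Finset.mem_univ, true_and]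
  exact ⟨Iso.symm, Iso.symm⟩

theorem nonempty_moduleTop_equiv_pi : Nonempty (ModuleTop S A ≃ₗ[S] ∀ j, E.Top j) := by
  obtain ⟨f⟩ := E.nonempty_quotient_equiv_pi E.jacobson_twoSided
  exact ⟨f.trans (LinearEquiv.piCongrRight fun j => Submodule.quotEquivOfEq _ _
    (E.submoduleOf_eq_jacobson E.mem_jacobson_of_mem_jacobson_ideal (E.e_notMem_jacobson j)))⟩

include E in
theorem isSemisimpleModule_moduleTop : IsSemisimpleModule S (ModuleTop S A) :=
  IsSemisimpleModule.congr E.nonempty_moduleTop_equiv_pi.some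

include E in
theorem length_moduleTop : Module.length S (ModuleTop S A) = Fintype.card ι := by
  rw [E.nonempty_moduleTop_equiv_pi.some.length_eq, Module.length_pi_of_fintype]
  simp only [Module.length_eq_one, Finset.sum_const, Finset.card_univ, nsmul_eq_mul, mul_one]

end TwoSided

/-! ### Socles and annihilators on the two sides -/

include E in
theorem socle_twoSided (x : A) (hx : x ∈ socle S A) (q : T) : q • x ∈ socle S A := by
  obtain ⟨b, rfl⟩ := E.t.surjective q
  exact map_socle_le (E.mulHom b) (Submodule.mem_map_of_mem hx)

include E in
theorem isotypicComponent_twoSided (V : Type*) [AddCommGroup V] [Module S V] [IsSimpleModule S V]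
    (x : A) (hx : x ∈ isotypicComponent S A V) (q : T) : q • x ∈ isotypicComponent S A V := by
  obtain ⟨b, rfl⟩ := E.t.surjective q
  exact (E.mulHom b).le_comap_isotypicComponent V hx

/-- The socle with respect to `T`, as an `S`-submodule. -/
def otherSocle : Submodule S A where
  carrier := socle T A
  add_mem' := (socle T A).add_mem
  zero_mem' := (socle T A).zero_mem
  smul_mem' r x hx := E.flip.socle_twoSided x hx r

theorem otherSocle_twoSided (x : A) (hx : x ∈ E.otherSocle) (q : T) : q • x ∈ E.otherSocle :=
  (socle T A).smul_mem q hx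

/-- The elements `a` such that `a x = 0` for all `x` in `X`. -/
def ann (X : Set A) : Submodule S A where
  carrier := {a | ∀ x ∈ X, E.t x • a = 0}
  add_mem' ha hb x hx := by rw [smul_add, ha x hx, hb x hx, add_zero]
  zero_mem' x _ := smul_zero _
  smul_mem' r a ha x hx := by rw [E.smul_comm, ha x hx, smul_zero]

theorem mem_ann {X : Set A} {a : A} : a ∈ E.ann X ↔ ∀ x ∈ X, E.s a • x = 0 :=
  forall₂_congr fun x _ => by rw [E.s_smul]

theorem ann_twoSided {X : Set A} (hX : ∀ x ∈ X, ∀ r : S, r • x ∈ X) (a : A)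
    (ha : a ∈ E.ann X) (q : T) : q • a ∈ E.ann X := by
  obtain ⟨b, rfl⟩ := E.t.surjective q
  rw [mem_ann] at ha ⊢
  intro x hx
  rw [← E.s_smul, map_smul, smul_assoc]
  exact ha _ (hX x hx _)

/-- Right multiplication by an element of the socle maps `A e_j` into a semisimple module, so it
kills the radical. Hence `dim_quotient` applies to the annihilators of parts of the socle. -/
theorem mem_ann_of_mem_jacobson_ideal {X : Set A} (hX : ∀ x ∈ X, x ∈ socle S A) (j : ι)
    (a : E.ideal j) (ha : a ∈ Module.jacobson S (E.ideal j)) : (a : A) ∈ E.ann X := by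
  rw [mem_ann]
  intro x hx
  exact congrArg Subtype.val (jacobson_le_ker_of_isSemisimpleModule
    (E.toHom (⟨x, hX x hx⟩ : socle S A) ∘ₗ (E.ideal j).subtype) ha)

/-! ### The Peirce components of a two-sided ideal -/

/-- The component of `Z` belonging to the idempotents `i` and `k` is nonzero. -/
def Linked (Z : Set A) (i k : ι) : Prop :=
  ∃ z ∈ Z, z ≠ 0 ∧ E.s (E.e i) • z = z ∧ E.t (E.e k) • z = z

theorem linked_flip {Z : Set A} {i k : ι} : E.flip.Linked Z k i ↔ E.Linked Z i k :=
  exists_congr fun _ => and_congr_right fun _ => and_congr_right fun _ => and_comm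

theorem s_smul_idem (i : ι) (M : Type*) [AddCommGroup M] [Module S M] (m : M) :
    E.s (E.e i) • E.s (E.e i) • m = E.s (E.e i) • m := by
  rw [← smul_assoc, ← map_smul, E.idem]

theorem linked_iff {N : Submodule S A} {i k : ι} :
    E.Linked N i k ↔ homLength (S := S) (E.ideal i) ↥(N ⊓ E.ideal k) ≠ 0 := by
  rw [E.homLength_ideal_ne_zero]
  constructor
  · rintro ⟨z, hz, h0, h1, h2⟩
    refine ⟨⟨z, hz, E.mem_ideal.2 h2⟩, fun h => h0 ?_⟩
    rw [← h1]
    exact congrArg Subtype.val h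
  · rintro ⟨⟨z, hz, hk⟩, h⟩
    refine ⟨E.s (E.e i) • z, N.smul_mem _ hz, fun h0 => h (Subtype.ext h0),
      E.s_smul_idem i A z, ?_⟩
    rw [E.smul_comm, E.mem_ideal.1 hk]

theorem exists_linked_iff {N : Submodule S A} {k : ι} :
    (∃ i, E.Linked N i k) ↔ N ⊓ E.ideal k ≠ ⊥ := by
  simp only [E.linked_iff]
  rw [← Submodule.nontrivial_iff_ne_bot]
  constructor
  · rintro ⟨i, hi⟩
    by_contra h
    rw [not_nontrivial_iff_subsingleton] at h
    refine hi ((homLength_eq_zero_iff _).2 fun f => LinearMap.ext fun x => Subsingleton.elim _ _)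
  · intro h
    exact E.exists_homLength_ne_zero _

variable {E} in
theorem Linked.homLength_ne_zero {N : Submodule S A} {i k : ι} (h : E.Linked N i k) :
    homLength (S := S) (E.ideal i) N ≠ 0 := by
  obtain ⟨z, hz, h0, h1, -⟩ := h
  refine E.homLength_ideal_ne_zero.2 ⟨⟨z, hz⟩, fun h => h0 ?_⟩
  rw [← h1]
  exact congrArg Subtype.val h

theorem homLength_eq_sum (i : ι) (N : Submodule S A) (hN : ∀ x ∈ N, ∀ q : T, q • x ∈ N) :
    homLength (S := S) (E.ideal i) N =
      ∑ k, homLength (S := S) (E.ideal i) ↥(N ⊓ E.ideal k) := by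
  rw [homLength_congr _ (E.decompose N hN), homLength_pi]

theorem dim_eq_sum (N : Submodule S A) (hN : ∀ x ∈ N, ∀ q : T, q • x ∈ N) :
    E.dim N = ∑ k, E.dim ↥(N ⊓ E.ideal k) := by
  rw [E.dim_congr (E.decompose N hN), dim_pi]

-- `e_i N` is the direct sum of the `e_i N e_k`, and each nonzero summand has length at least one.
open Classical in
theorem card_linked_le_homLength (i : ι) (N : Submodule S A)
    (hN : ∀ x ∈ N, ∀ q : T, q • x ∈ N) :
    ((Finset.univ.filter fun k => E.Linked N i k).card : ℕ∞) ≤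
      homLength (S := S) (E.ideal i) N := by
  rw [E.homLength_eq_sum i N hN, ← Finset.sum_boole]
  refine Finset.sum_le_sum fun k _ => ?_
  split_ifs with h
  · exact Order.one_le_iff_ne_zero.2 (E.linked_iff.1 h)
  · exact zero_le

/-! ### Homogeneous components -/

theorem homLength_component {i k : ι} (h : E.Iso i k) :
    homLength (S := S) (E.ideal i) (isotypicComponent S A (E.Top k)) =
      homLength (S := S) (E.ideal k) (socle S A) := by
  rw [homLength_isotypicComponent (E.isLocalModule_ideal i) h.nonempty_top_equiv.some,
    homLength_congr_left (E.iso_iff.1 h).some]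

/-- Only the `μ_k` idempotents isomorphic to `e_k` detect this component, and each sees the full
multiplicity of its simple module in the socle. -/
theorem dim_component (k : ι) : E.dim (isotypicComponent S A (E.Top k)) =
    E.multiplicity k * homLength (S := S) (E.ideal k) (socle S A) := by
  classical
  rw [multiplicity, ← Finset.sum_boole, Finset.sum_mul]
  refine Finset.sum_congr rfl fun i _ => ?_
  split_ifs with h
  · rw [E.homLength_component h, one_mul]
  · rw [zero_mul]
    exact homLength_isotypicComponent_eq_zero (E.isLocalModule_ideal i)
      fun ⟨f⟩ => h (E.iso_of_top_equiv f)

/-- The homogeneous component of the `S`-module `A` belonging to `k`. -/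
abbrev component (k : ι) : Submodule S A := isotypicComponent S A (E.Top k)

variable {E} in
/-- The homogeneous components of isomorphic idempotents agree. -/
theorem Iso.component_eq {i k : ι} (h : E.Iso i k) : E.component i = E.component k := by
  obtain ⟨f⟩ := h.nonempty_top_equiv
  exact f.isotypicComponent_eq

/-- If the `T`-component belonging to `k` has multiplicity `a`, then the quotient by its
annihilator embeds into `a` copies of the part of the `T`-socle in the principal ideal of `e k`. -/
theorem exists_hom_ker_eq_ann {k : ι} {a : ℕ}
    (ha : homLength (S := T) (E.flip.ideal k) (socle T A) = a) :
    ∃ f : A →ₗ[S] Fin a → ↥(E.otherSocle ⊓ E.ideal k),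
      LinearMap.ker f = E.ann (E.flip.component k) := by
  have hle : E.flip.component k ≤ socle T A := isotypicComponent_le_socle
  -- The Hom module has length `a` over the endomorphism ring, so `a` maps generate it. Their values
  -- `y j` at `e_k` define `f r = (r y_j)_j`.
  obtain ⟨x, hx⟩ := exists_fin_span_eq_top a (E.flip.ideal k →ₗ[T] E.flip.component k)
    ((E.flip.homLength_component (Iso.refl _ k)).trans ha)
  let y : Fin a → E.flip.component k := fun j => x j ⟨E.e k, E.flip.e_mem k⟩
  have hy : ∀ j, (y j : A) ∈ E.otherSocle ⊓ E.ideal k := fun j => by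
    refine ⟨hle (y j).2, E.mem_ideal.2 ?_⟩
    have h1 : E.t (E.e k) • (⟨E.e k, E.flip.e_mem k⟩ : E.flip.ideal k) =
      ⟨E.e k, E.flip.e_mem k⟩ := Subtype.ext (E.t_smul_e k)
    have h2 := congrArg (fun p => (x j p : A)) h1
    simpa using h2
  let f : A →ₗ[S] Fin a → ↥(E.otherSocle ⊓ E.ideal k) :=
    LinearMap.pi fun j => E.toHom ⟨(y j : A), hy j⟩
  have hf : ∀ r, f r = 0 ↔ ∀ j, E.s r • (y j : A) = 0 := fun r => by
    rw [funext_iff]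
    exact forall_congr' fun j => ⟨fun h => congrArg Subtype.val h, fun h => Subtype.ext h⟩
  refine ⟨f, ?_⟩
  ext r
  rw [LinearMap.mem_ker, hf, mem_ann]
  refine ⟨fun h => ?_, fun h j => h _ (y j).2⟩
  -- If `r` kills all `y j`, it kills the image of every map from `e_k A` to the component:
  -- endomorphisms act by precomposition, which does not enlarge images.
  have hall : ∀ g : E.flip.ideal k →ₗ[T] E.flip.component k, ∀ p, E.s r • (g p : A) = 0 := by
    intro g
    have hg : g ∈ Submodule.span _ (Set.range x) := hx ▸ Submodule.mem_top
    induction hg using Submodule.span_induction with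
    | mem g hg =>
      obtain ⟨j, rfl⟩ := hg
      rintro ⟨p, hp⟩
      obtain ⟨q, rfl⟩ := Submodule.mem_span_singleton.1 hp
      have h1 : x j ⟨q • E.flip.e k, hp⟩ = q • y j := map_smul (x j) q ⟨E.e k, E.flip.e_mem k⟩
      rw [h1, Submodule.coe_smul, ← E.smul_comm]
      exact (congrArg (q • ·) (h j)).trans (smul_zero _)
    | zero => intro p; exact smul_zero _
    | add g g' _ _ hg hg' =>
      intro p
      rw [LinearMap.add_apply, Submodule.coe_add, smul_add, hg, hg', add_zero]
    | smul b g _ hg => exact fun p => hg (b.unop p)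
  -- The component is spanned by copies of the top of `e_k A`, each an image of `e_k A`.
  have hker : E.flip.component k ≤ LinearMap.ker (E.flip.mulHom r) := by
    refine sSup_le fun N ⟨g⟩ c hc => ?_
    have hN : N ≤ E.flip.component k := le_sSup ⟨g⟩
    obtain ⟨p, hp⟩ := (Module.jacobson T (E.flip.ideal k)).mkQ_surjective (g ⟨c, hc⟩)
    have := hall (Submodule.inclusion hN ∘ₗ g.symm.toLinearMap ∘ₗ Submodule.mkQ _) p
    simp only [LinearMap.comp_apply, hp] at this
    rw [LinearEquiv.coe_coe, LinearEquiv.symm_apply_apply] at this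
    exact this
  exact fun c hc => hker hc

/-- A map to a semisimple module factors through `A/rad A`, which contains the top of `A e_j`
exactly `μ_j` times. -/
theorem le_multiplicity_of_surjective {n : ℕ} {j : ι}
    (f : A →ₗ[S] Fin n → E.Top j) (hf : Function.Surjective f) : n ≤ E.multiplicity j := by
  let g : ModuleTop S A →ₗ[S] Fin n → E.Top j :=
    (Module.jacobson S A).liftQ f (jacobson_le_ker_of_isSemisimpleModule f)
  have hg : Function.Surjective g := fun y => by
    obtain ⟨x, rfl⟩ := hf y
    exact ⟨Submodule.Quotient.mk x, Submodule.liftQ_apply _ _ _⟩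
  have := homLength_le_of_surjective (E.ideal j) g hg
  classical
  rw [homLength_pi, E.homLength_ideal_moduleTop] at this
  simp only [homLength_ideal_top, if_pos (Iso.refl E j), Finset.sum_const, Finset.card_univ,
    Fintype.card_fin, nsmul_eq_mul, mul_one] at this
  exact_mod_cast this

/-! ### Consequences of the dimension conditions -/

/-- Both sides say `S_r e_k = 0`. Thus `d(R/r(S_r))` is the sum of the `μ_k` over the `k` with `S_r
e_k ≠ 0`. -/
theorem e_mem_ann_flip_iff {k : ι} :
    E.e k ∈ E.flip.ann (socle T A : Set A) ↔ ¬ ∃ i, E.Linked (socle T A) i k := by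
  have h1 := E.exists_linked_iff (N := E.otherSocle) (k := k)
  change (∃ i, E.Linked (socle T A) i k) ↔ _ at h1
  rw [h1, not_not, Submodule.eq_bot_iff]
  constructor
  · rintro h x ⟨hx, hk⟩
    have h2 : E.s x • E.e k = 0 := h x hx
    rw [← E.mem_ideal.1 hk, ← E.s_smul, h2]
  · intro h x hx
    change E.s x • E.e k = 0
    refine h _ ⟨?_, Submodule.smul_mem _ _ (E.e_mem k)⟩
    rw [E.s_smul]
    exact E.otherSocle_twoSided x hx _

theorem exists_homLength_eq {i k : ι}
    (hc : E.flip.dim (E.flip.component k) = E.dim (A ⧸ E.ann (E.flip.component k)))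
    (hfin : E.flip.dim (E.flip.component k) ≠ ⊤) (hik : E.Linked (socle T A) i k) :
    ∃ a : ℕ, a ≠ 0 ∧ homLength (S := T) (E.flip.ideal k) (socle T A) = a ∧
      (E.multiplicity k : ℕ∞) * a = E.dim (A ⧸ E.ann (E.flip.component k)) := by
  have h0 : homLength (S := T) (E.flip.ideal k) (socle T A) ≠ 0 :=
    (E.linked_flip.2 hik).homLength_ne_zero
  rw [E.flip.dim_component, E.multiplicity_flip] at hc hfin
  have hpos := E.multiplicity_pos k
  obtain ⟨a, ha⟩ := ENat.ne_top_iff_exists.1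
    (show homLength (S := T) (E.flip.ideal k) (socle T A) ≠ ⊤ from fun h => hfin (by
      rw [h, ENat.mul_top (by exact_mod_cast hpos.ne')]))
  refine ⟨a, fun h => h0 (by rw [← ha, h]; rfl), ha.symm, ?_⟩
  rw [ha, hc]

/-- The embedding of `A/l(S_k)` into `a` copies of `S_r e_k` gives `μ_k a ≤ a d(S_r e_k)`, and `a`
can be cancelled because it is finite and nonzero. -/
theorem multiplicity_le_dim {i k : ι}
    (hc : E.flip.dim (E.flip.component k) = E.dim (A ⧸ E.ann (E.flip.component k)))
    (hfin : E.flip.dim (E.flip.component k) ≠ ⊤) (hik : E.Linked (socle T A) i k) :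
    (E.multiplicity k : ℕ∞) ≤ E.dim ↥(E.otherSocle ⊓ E.ideal k) := by
  obtain ⟨a, ha0, ha, h⟩ := E.exists_homLength_eq hc hfin hik
  obtain ⟨f, hf⟩ := E.exists_hom_ker_eq_ann ha
  have hinj : Function.Injective ((LinearMap.ker f).liftQ f le_rfl) :=
    LinearMap.ker_eq_bot.1 (Submodule.ker_liftQ_eq_bot _ _ _ le_rfl)
  have hle := E.dim_le_of_injective _ hinj
  rw [hf, ← h, dim_pi, Finset.sum_const, Finset.card_univ, Fintype.card_fin, nsmul_eq_mul] at hle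
  generalize E.dim ↥(E.otherSocle ⊓ E.ideal k) = D at hle ⊢
  cases D with
  | top => exact le_top
  | coe D =>
    norm_cast at hle ⊢
    exact Nat.le_of_mul_le_mul_left (by rwa [mul_comm a]) (Nat.pos_of_ne_zero ha0)

theorem eq_of_sum_eq_sum {f g : ι → ℕ∞} (h : ∀ j, f j ≤ g j) (hs : ∑ j, g j = ∑ j, f j)
    (hfin : ∀ j, f j ≠ ⊤) (k : ι) : g k = f k := by
  have hgs : ∑ j, g j ≠ ⊤ := by rw [hs]; exact ENat.sum_ne_top.2 fun j _ => hfin j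
  have hg : ∀ j, g j ≠ ⊤ := fun j => ENat.sum_ne_top.1 hgs j (Finset.mem_univ j)
  choose f' hf' using fun j => ENat.ne_top_iff_exists.1 (hfin j)
  choose g' hg' using fun j => ENat.ne_top_iff_exists.1 (hg j)
  simp only [← hf', ← hg'] at h hs ⊢
  norm_cast at hs ⊢
  exact ((Finset.sum_eq_sum_iff_of_le fun j _ => by exact_mod_cast h j).1 hs.symm k
    (Finset.mem_univ k)).symm

/-- If the dimension conditions hold, then each nonzero part `Z e_k` of the `T`-socle `Z` has
generalised dimension `μ_k`. -/
theorem dim_otherSocle_inf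
    (ha : E.dim E.otherSocle = E.flip.dim (A ⧸ E.flip.ann (socle T A : Set A)))
    (hc : ∀ k, E.flip.dim (E.flip.component k) = E.dim (A ⧸ E.ann (E.flip.component k)))
    (hfin : ∀ k, E.flip.dim (E.flip.component k) ≠ ⊤) {i k : ι}
    (hik : E.Linked (socle T A) i k) :
    E.dim ↥(E.otherSocle ⊓ E.ideal k) = E.multiplicity k := by
  classical
  rw [E.dim_eq_sum _ E.otherSocle_twoSided, E.flip.dim_quotient
    (E.flip.ann_twoSided fun x hx r => (socle T A).smul_mem r hx)
    (E.flip.mem_ann_of_mem_jacobson_ideal fun x hx => hx)] at ha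
  have hle : ∀ j, (if E.flip.e j ∈ E.flip.ann (socle T A : Set A) then 0 else
      (E.flip.multiplicity j : ℕ∞)) ≤ E.dim ↥(E.otherSocle ⊓ E.ideal j) := fun j => by
    split_ifs with h
    · exact zero_le
    · rw [flip_e, e_mem_ann_flip_iff, not_not] at h
      rw [E.multiplicity_flip]
      exact E.multiplicity_le_dim (hc j) (hfin j) h.choose_spec
  have hne : E.flip.e k ∉ E.flip.ann (socle T A : Set A) := by
    rw [flip_e, e_mem_ann_flip_iff, not_not]; exact ⟨i, hik⟩
  have := eq_of_sum_eq_sum hle ha (fun j => by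
    split_ifs
    · exact ENat.zero_ne_top
    · exact ENat.natCast_ne_top _) k
  rwa [if_neg hne, E.multiplicity_flip] at this

/-- The structure of the parts of the `T`-socle forced by the dimension conditions. -/
theorem linked_iff_iso_of_dim
    (ha : E.dim E.otherSocle = E.flip.dim (A ⧸ E.flip.ann (socle T A : Set A)))
    (hc : ∀ k, E.flip.dim (E.flip.component k) = E.dim (A ⧸ E.ann (E.flip.component k)))
    (hfin : ∀ k, E.flip.dim (E.flip.component k) ≠ ⊤) {i k : ι}
    (hik : E.Linked (socle T A) i k) :
    (∀ i', E.Linked (socle T A) i' k ↔ E.Iso i' i) ∧ E.multiplicity i ≤ E.multiplicity k ∧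
      (E.multiplicity i = E.multiplicity k →
        IsSimpleModule S ↥(E.otherSocle ⊓ E.ideal k)) := by
  classical
  have hdim := E.dim_otherSocle_inf ha hc hfin hik
  have hdimfin : E.dim ↥(E.otherSocle ⊓ E.ideal k) ≠ ⊤ := by
    rw [hdim]; exact ENat.natCast_ne_top _
  obtain ⟨a, ha0, hlen, hdimq⟩ := E.exists_homLength_eq (hc k) (hfin k) hik
  obtain ⟨f, hf⟩ := E.exists_hom_ker_eq_ann hlen
  have hpi : E.dim (Fin a → ↥(E.otherSocle ⊓ E.ideal k)) = E.multiplicity k * a := by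
    rw [dim_pi, Finset.sum_const, Finset.card_univ, Fintype.card_fin, nsmul_eq_mul, hdim, mul_comm]
  -- `A/l(S_k)` embeds into `(S_r e_k)^a`, and both now have dimension `μ_k a`.
  have hfs : Function.Surjective f := by
    rw [← hf] at hdimq
    have hinj : Function.Injective ((LinearMap.ker f).liftQ f le_rfl) :=
      LinearMap.ker_eq_bot.1 (Submodule.ker_liftQ_eq_bot _ _ _ le_rfl)
    have := E.surjective_of_dim_le _ hinj (by rw [hpi, hdimq])
      (by rw [← hdimq]; exact_mod_cast ENat.natCast_ne_top (E.multiplicity k * a))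
    intro y
    obtain ⟨x, rfl⟩ := this y
    obtain ⟨x, rfl⟩ := Submodule.mkQ_surjective _ x
    exact ⟨x, (Submodule.liftQ_apply _ _ _).symm⟩
  have hnt : Nontrivial ↥(E.otherSocle ⊓ E.ideal k) :=
    Submodule.nontrivial_iff_ne_bot.2 (E.exists_linked_iff.1 ⟨i, hik⟩)
  have hnoeth := (isFiniteLength_iff_isNoetherian_isArtinian.1
    (E.isFiniteLength_of_dim_ne_top hdimfin)).1
  obtain ⟨K, hK⟩ := IsCoatomic.exists_coatom (Submodule S ↥(E.otherSocle ⊓ E.ideal k))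
  have := isSimpleModule_iff_isCoatom.2 hK
  obtain ⟨j, ⟨g⟩⟩ := E.exists_top_equiv (↥(E.otherSocle ⊓ E.ideal k) ⧸ K)
  let p : ↥(E.otherSocle ⊓ E.ideal k) →ₗ[S] E.Top j := g.symm.toLinearMap ∘ₗ K.mkQ
  have hp : Function.Surjective p := g.symm.surjective.comp K.mkQ_surjective
  -- Composing `f` with `a` copies of the simple quotient `p` maps `A` onto `a` copies of the top of
  -- `A e_j`.
  have haj : a ≤ E.multiplicity j := by
    refine E.le_multiplicity_of_surjective (LinearMap.pi fun l => p ∘ₗ LinearMap.proj l ∘ₗ f) ?_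
    intro y
    choose x hx using fun l => hp (y l)
    obtain ⟨r, hr⟩ := hfs x
    exact ⟨r, funext fun l => by rw [← hx l, ← hr]; rfl⟩
  have hsub : ∀ i', E.Iso i' j → E.Linked (socle T A) i' k := fun i' h => by
    refine (E.linked_iff (N := E.otherSocle)).2 fun h0 => ?_
    have := homLength_le_of_surjective (E.ideal i') p hp
    rw [h0, homLength_ideal_top, if_pos h] at this
    simp at this
  have hcard := E.flip.card_linked_le_homLength k (socle T A)
    fun x hx r => E.flip.socle_twoSided x hx r
  rw [hlen] at hcard
  simp only [linked_flip] at hcard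
  -- The class of `j`, of size `μ_j`, lies in the set of `i'` with `e_i' S_r e_k ≠ 0`. That set has
  -- at most `a ≤ μ_j` elements, so the two agree.
  have hset := Finset.eq_of_subset_of_card_le
    (s := Finset.univ.filter fun i' => E.Iso i' j)
    (t := Finset.univ.filter fun i' => E.Linked (socle T A) i' k)
    (fun i' h => by simpa using hsub i' (by simpa using h))
    ((by exact_mod_cast hcard : _ ≤ a).trans haj)
  have hiff : ∀ i', E.Linked (socle T A) i' k ↔ E.Iso i' j := fun i' => by
    have := congrArg (i' ∈ ·) hset
    simpa using this.symm
  have hij := (hiff i).1 hik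
  have hle := E.dim_le_of_surjective p hp
  rw [hdim, dim_top] at hle
  refine ⟨fun i' => (hiff i').trans ⟨fun h => h.trans hij.symm, fun h => h.trans hij⟩, ?_, ?_⟩
  · rw [hij.multiplicity_eq]
    exact_mod_cast hle
  · intro heq
    -- With equal multiplicities, `S_r e_k` and its simple quotient have the same finite dimension,
    -- so they coincide.
    have hpi := E.injective_of_dim_le p hp (by rw [hdim, dim_top, ← heq, hij.multiplicity_eq])
      (by rw [dim_top]; exact ENat.natCast_ne_top _)
    exact IsSimpleModule.congr (LinearEquiv.ofBijective p ⟨hpi, hp⟩)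

/-! ### Peirce components when the pieces of the socle are simple -/

variable {E} in
theorem Linked.of_iso {Z : Set A} (hZ : ∀ x ∈ Z, ∀ r : S, r • x ∈ Z) {i i' k : ι}
    (h : E.Linked Z i k) (h' : E.Iso i i') : E.Linked Z i' k := by
  obtain ⟨z, hz, h0, h1, h2⟩ := h
  obtain ⟨x, y, hxy, hyx⟩ := h'
  have hxyz : E.s x • E.s y • z = z := by rw [← smul_assoc, ← map_smul, hxy, h1]
  refine ⟨E.s y • z, hZ z hz _, fun h => h0 (by rw [← hxyz, h, smul_zero]), ?_, ?_⟩
  · rw [← hyx, map_smul, smul_assoc, hxyz]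
  · rw [E.smul_comm, h2]

variable {E} in
theorem Linked.nonempty_top_equiv {N : Submodule S A} {i k : ι}
    [IsSimpleModule S ↥(N ⊓ E.ideal k)] (h : E.Linked N i k) :
    Nonempty (E.Top i ≃ₗ[S] ↥(N ⊓ E.ideal k)) := by
  have h1 := E.linked_iff.1 h
  rw [Ne, homLength_eq_zero_iff] at h1
  push Not at h1
  obtain ⟨f, hf⟩ := h1
  exact (E.isLocalModule_ideal i).nonempty_top_equiv hf

variable {E} in
theorem Linked.linked_iff_iso {N : Submodule S A} {i k : ι}
    [IsSimpleModule S ↥(N ⊓ E.ideal k)] (h : E.Linked N i k) (i' : ι) :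
    E.Linked N i' k ↔ E.Iso i' i := by
  refine ⟨fun h' => ?_, fun h' => h.of_iso (fun x hx r => N.smul_mem r hx) h'.symm⟩
  obtain ⟨f⟩ := h.nonempty_top_equiv
  obtain ⟨f'⟩ := h'.nonempty_top_equiv
  exact E.iso_of_top_equiv (f'.trans f.symm)

open Classical in
theorem homLength_eq_card_linked {N : Submodule S A} (hN : ∀ x ∈ N, ∀ q : T, q • x ∈ N)
    (hs : ∀ k, IsSimpleModule S ↥(N ⊓ E.ideal k)) (i : ι) :
    homLength (S := S) (E.ideal i) N = (Finset.univ.filter fun k => E.Linked N i k).card := by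
  rw [E.homLength_eq_sum i N hN, ← Finset.sum_boole]
  refine Finset.sum_congr rfl fun k _ => ?_
  have := hs k
  split_ifs with h
  · have h1 := E.linked_iff.1 h
    rw [Ne, homLength_eq_zero_iff] at h1
    push Not at h1
    exact homLength_eq_one _ h1.choose_spec
  · by_contra h0
    exact h (E.linked_iff.2 h0)

theorem ideal_ne_bot (k : ι) : E.ideal k ≠ ⊥ := fun h =>
  E.e_ne_zero k ((Submodule.eq_bot_iff _).1 h _ (E.e_mem k))

/-- The two socles coincide, the socle of every principal ideal is simple, and the resulting
matching of the idempotents preserves multiplicities. -/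
structure HasSimpleSocles : Prop where
  mem_socle_iff : ∀ x, x ∈ socle S A ↔ x ∈ socle T A
  isSimpleModule : ∀ k, IsSimpleModule S ↥(socle S A ⊓ E.ideal k)
  isSimpleModule_flip : ∀ k, IsSimpleModule T ↥(socle T A ⊓ E.flip.ideal k)
  multiplicity_eq : ∀ i k, E.Linked (socle S A) i k → E.multiplicity i = E.multiplicity k

namespace HasSimpleSocles

variable {E}

theorem coe_socle_eq (h : E.HasSimpleSocles) : (socle S A : Set A) = socle T A :=
  Set.ext h.mem_socle_iff

theorem flip (h : E.HasSimpleSocles) : E.flip.HasSimpleSocles where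
  mem_socle_iff x := (h.mem_socle_iff x).symm
  isSimpleModule := h.isSimpleModule_flip
  isSimpleModule_flip := h.isSimpleModule
  multiplicity_eq i k hik := by
    rw [← h.coe_socle_eq, linked_flip] at hik
    rw [multiplicity_flip, multiplicity_flip, h.multiplicity_eq k i hik]

theorem exists_linked (h : E.HasSimpleSocles) (k : ι) : ∃ i, E.Linked (socle S A) i k := by
  rw [E.exists_linked_iff]
  have := h.isSimpleModule k
  have := IsSimpleModule.nontrivial S ↥(socle S A ⊓ E.ideal k)
  exact Submodule.nontrivial_iff_ne_bot.1 this

theorem exists_linked' (h : E.HasSimpleSocles) (i : ι) : ∃ k, E.Linked (socle S A) i k := by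
  obtain ⟨k, hk⟩ := h.flip.exists_linked i
  rw [← h.coe_socle_eq, linked_flip] at hk
  exact ⟨k, hk⟩

theorem linked_iff_iso (h : E.HasSimpleSocles) {i k : ι} (hik : E.Linked (socle S A) i k)
    (i' : ι) : E.Linked (socle S A) i' k ↔ E.Iso i' i :=
  have := h.isSimpleModule k
  Linked.linked_iff_iso hik i'

theorem linked_iff_iso' (h : E.HasSimpleSocles) {i k : ι} (hik : E.Linked (socle S A) i k)
    (k' : ι) : E.Linked (socle S A) i k' ↔ E.Iso k' k := by
  rw [h.coe_socle_eq, ← linked_flip] at hik ⊢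
  exact (h.flip.linked_iff_iso hik k').trans E.iso_flip

/-- Since the `S_l e_k` are simple, the multiplicity is the number of `k` with `e_i S_l e_k ≠ 0`.
These form one class, of size `μ_k = μ_i`. -/
theorem homLength_socle (h : E.HasSimpleSocles) (i : ι) :
    homLength (S := S) (E.ideal i) (socle S A) = E.multiplicity i := by
  classical
  obtain ⟨k, hk⟩ := h.exists_linked' i
  rw [E.homLength_eq_card_linked E.socle_twoSided h.isSimpleModule, h.multiplicity_eq i k hk]
  simp only [h.linked_iff_iso' hk, multiplicity]

theorem dim_socle (h : E.HasSimpleSocles) :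
    E.dim (socle S A) = ∑ i, (E.multiplicity i : ℕ∞) :=
  Finset.sum_congr rfl fun i _ => h.homLength_socle i

theorem dim_otherSocle (h : E.HasSimpleSocles) :
    E.dim E.otherSocle = ∑ i, (E.multiplicity i : ℕ∞) := by
  have : E.otherSocle = socle S A := Submodule.ext fun x => (h.mem_socle_iff x).symm
  rw [this, h.dim_socle]

theorem dim_quotient_ann (h : E.HasSimpleSocles) :
    E.flip.dim (A ⧸ E.flip.ann (socle T A : Set A)) = ∑ i, (E.multiplicity i : ℕ∞) := by
  classical
  rw [E.flip.dim_quotient (E.flip.ann_twoSided fun x hx r => (socle T A).smul_mem r hx)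
    (E.flip.mem_ann_of_mem_jacobson_ideal fun x hx => hx)]
  refine Finset.sum_congr rfl fun k _ => ?_
  rw [flip_e, E.e_mem_ann_flip_iff, if_neg (not_not.2 ?_), multiplicity_flip]
  rw [← h.coe_socle_eq]
  exact h.exists_linked k

theorem dim_component (h : E.HasSimpleSocles) (k : ι) :
    E.dim (E.component k) = (E.multiplicity k * E.multiplicity k : ℕ) := by
  rw [E.dim_component, h.homLength_socle]
  push_cast
  rfl

/-- The product of the component `S'_k` with `e_i` lies in the simple module `S_l e_i`. It is
nonzero exactly when that module is a copy of the top of `A e_k`, that is, when `e_k S_l e_i ≠ 0`.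
-/
theorem e_mem_ann_component_iff (h : E.HasSimpleSocles) (i k : ι) :
    E.e i ∈ E.flip.ann (E.component k : Set A) ↔ ¬ E.Linked (socle S A) k i := by
  have hle : E.component k ≤ socle S A := isotypicComponent_le_socle
  have := h.isSimpleModule i
  have hatom : IsAtom (socle S A ⊓ E.ideal i) := isSimpleModule_iff_isAtom.1 inferInstance
  constructor
  · intro hi hki
    obtain ⟨f⟩ := hki.nonempty_top_equiv
    obtain ⟨z, hz, h0, h1, h2⟩ := hki
    have hzc : z ∈ E.component k :=
      (le_sSup ⟨f.symm⟩ : socle S A ⊓ E.ideal i ≤ E.component k) ⟨hz, E.mem_ideal.2 h2⟩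
    have h3 : E.s z • E.e i = 0 := hi z hzc
    rw [E.s_smul, h2] at h3
    exact h0 h3
  · intro hki c hc
    by_contra hne
    have hne' : E.t (E.e i) • c ≠ 0 := by rwa [← E.s_smul]
    have hmem : E.t (E.e i) • c ∈ E.component k ⊓ E.ideal i :=
      ⟨E.isotypicComponent_twoSided _ c hc _, by
        rw [← E.s_smul]; exact Submodule.smul_mem _ _ (E.e_mem i)⟩
    have heq : E.component k ⊓ E.ideal i = socle S A ⊓ E.ideal i := by
      refine (hatom.le_iff.1 (inf_le_inf_right _ hle)).resolve_left fun h0 => hne' ?_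
      exact (Submodule.eq_bot_iff _).1 h0 _ hmem
    have hle' : socle S A ⊓ E.ideal i ≤ E.component k := heq ▸ inf_le_left
    obtain ⟨f⟩ := isIsotypicOfType_submodule_iff.1
      (IsIsotypicOfType.isotypicComponent S A (E.Top k)) _ hle'
    refine hki (E.linked_iff.2 ?_)
    classical
    rw [homLength_congr _ f, homLength_ideal_top, if_pos (Iso.refl E k)]
    exact one_ne_zero

theorem dim_quotient_ann_component (h : E.HasSimpleSocles) (k : ι) :
    E.flip.dim (A ⧸ E.flip.ann (E.component k : Set A)) =
      (E.multiplicity k * E.multiplicity k : ℕ) := by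
  classical
  have hle : E.component k ≤ socle S A := isotypicComponent_le_socle
  obtain ⟨i, hi⟩ := h.exists_linked' k
  rw [E.flip.dim_quotient
    (E.flip.ann_twoSided fun x hx r => E.isotypicComponent_twoSided _ x hx r)
    (E.flip.mem_ann_of_mem_jacobson_ideal fun x hx => (h.mem_socle_iff x).1 (hle hx))]
  simp only [flip_e, h.e_mem_ann_component_iff, ite_not, multiplicity_flip, h.linked_iff_iso' hi]
  rw [← Finset.sum_filter]
  have : ∀ j ∈ Finset.univ.filter fun j => E.Iso j i,
      (E.multiplicity j : ℕ∞) = E.multiplicity k := fun j hj => by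
    rw [h.multiplicity_eq k i hi, (Finset.mem_filter.1 hj).2.multiplicity_eq]
  -- The sum runs over a class of `μ_i = μ_k` idempotents and each contributes `μ_k`, which gives
  -- the square found in `dim_component`.
  rw [Finset.sum_congr rfl this, Finset.sum_const, nsmul_eq_mul]
  push_cast
  congr 2
  rw [h.multiplicity_eq k i hi]
  rfl

theorem nonempty_socle_equiv (h : E.HasSimpleSocles) {i k : ι}
    (hik : E.Linked (socle S A) i k) :
    Nonempty (socle S (E.ideal k) ≃ₗ[S] E.Top i) := by
  have := h.isSimpleModule k
  obtain ⟨f⟩ := hik.nonempty_top_equiv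
  exact ⟨(socleEquiv _).trans f.symm⟩

end HasSimpleSocles

theorem nonempty_socle_equiv_moduleTop
    (h : ∀ i, homLength (S := S) (E.ideal i) (socle S A) = E.multiplicity i) :
    Nonempty (socle S A ≃ₗ[S] ModuleTop S A) := by
  have := E.isSemisimpleModule_moduleTop
  refine E.nonempty_equiv_of_homLength_eq (fun i => by rw [h, E.homLength_ideal_moduleTop]) ?_
  rw [dim, ENat.sum_ne_top]
  intro i _
  rw [h]
  exact ENat.natCast_ne_top _

/-! ### Simple socles from each of the conditions, using essentiality -/

section Essential

/-- The socle has length `card ι`, the length of the top, and splits into `card ι` pieces that are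
nonzero by essentiality. Each piece therefore has length one. -/
theorem isSimpleModule_of_socle_equiv (hess : IsEssential (socle S A))
    (f : socle S A ≃ₗ[S] ModuleTop S A) (k : ι) : IsSimpleModule S ↥(socle S A ⊓ E.ideal k) := by
  have h := f.length_eq
  rw [E.length_moduleTop, (E.decompose _ E.socle_twoSided).length_eq,
    Module.length_pi_of_fintype] at h
  rw [← Module.length_eq_one_iff]
  refine eq_of_sum_eq_sum (f := fun _ => (1 : ℕ∞))
    (g := fun k => Module.length S ↥(socle S A ⊓ E.ideal k)) (fun j => ?_) (by simpa using h)
    (fun _ => ENat.one_ne_top) k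
  rw [Order.one_le_iff_pos, Module.length_pos_iff, Submodule.nontrivial_iff_ne_bot]
  exact hess _ (E.ideal_ne_bot j)

theorem inf_ideal_le_of_isSimpleModule (hess : IsEssential (socle S A)) {N : Submodule S A}
    {k : ι} [IsSimpleModule S ↥(socle S A ⊓ E.ideal k)] (hN : N ⊓ E.ideal k ≠ ⊥) :
    socle S A ⊓ E.ideal k ≤ N := by
  have hatom : IsAtom (socle S A ⊓ E.ideal k) := isSimpleModule_iff_isAtom.1 inferInstance
  have h := (hatom.le_iff.1 (inf_le_inf_left (socle S A)
    (inf_le_right : N ⊓ E.ideal k ≤ E.ideal k))).resolve_left (hess _ hN)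
  rw [← h]
  exact inf_le_right.trans inf_le_left

theorem le_of_inf_ideal_le {N N' : Submodule S A} (hN : ∀ x ∈ N, ∀ q : T, q • x ∈ N)
    (h : ∀ k, N ⊓ E.ideal k ≤ N') : N ≤ N' := fun x hx => by
  rw [← E.sum_t_smul x]
  refine sum_mem fun k _ => h k ⟨hN x hx _, ?_⟩
  rw [← E.s_smul]
  exact Submodule.smul_mem _ _ (E.e_mem k)

/-- `S_r` contains every simple right module, so `S_r e_k ≠ 0`. By essentiality it meets the simple
module `S_l e_k`, hence contains it; summing over `k` gives the inclusion. -/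
theorem socle_le_otherSocle (hess : IsEssential (socle S A))
    (f : socle S A ≃ₗ[S] ModuleTop S A) (g : socle T A ≃ₗ[T] ModuleTop T A) :
    socle S A ≤ E.otherSocle := by
  refine E.le_of_inf_ideal_le E.socle_twoSided fun k => ?_
  have := E.isSimpleModule_of_socle_equiv hess f k
  refine E.inf_ideal_le_of_isSimpleModule hess ?_
  have hk : homLength (S := T) (E.flip.ideal k) (socle T A) ≠ 0 := by
    rw [homLength_congr _ g, E.flip.homLength_ideal_moduleTop]
    exact_mod_cast (E.flip.multiplicity_pos k).ne'
  obtain ⟨⟨z, hz⟩, hzk⟩ := E.flip.homLength_ideal_ne_zero.1 hk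
  intro h0
  refine hzk (Subtype.ext ((Submodule.eq_bot_iff _).1 h0 (E.t (E.e k) • z) ⟨?_, ?_⟩))
  · exact (socle T A).smul_mem _ hz
  · rw [← E.s_smul]; exact Submodule.smul_mem _ _ (E.e_mem k)

/-- If both socles are isomorphic to the tops, then the socles of the principal ideals are
simple and match the idempotents. -/
theorem hasSimpleSocles_of_equiv (hess : IsEssential (socle S A)) (hess' : IsEssential (socle T A))
    (f : socle S A ≃ₗ[S] ModuleTop S A) (g : socle T A ≃ₗ[T] ModuleTop T A) :
    E.HasSimpleSocles := by
  classical
  have h1 := E.socle_le_otherSocle hess f g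
  have h2 := E.flip.socle_le_otherSocle hess' g f
  have hiff : ∀ x, x ∈ socle S A ↔ x ∈ socle T A := fun x => ⟨fun h => h1 h, fun h => h2 h⟩
  have hs := E.isSimpleModule_of_socle_equiv hess f
  have hs' := E.flip.isSimpleModule_of_socle_equiv hess' g
  refine ⟨hiff, hs, hs', fun i k hik => ?_⟩
  -- The number of `k'` with `e_i S_l e_k' ≠ 0` is `μ_i` by the isomorphism with the top, and `μ_k`
  -- because simplicity of `e_i S_r` makes these `k'` the class of `k`.
  have h3 := E.homLength_eq_card_linked E.socle_twoSided hs i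
  have hset : (socle S A : Set A) = socle T A := Set.ext hiff
  have hik' := hik
  rw [hset, ← linked_flip] at hik'
  have := hs' i
  have hl : ∀ k', E.Linked (socle S A) i k' ↔ E.Iso k' k := fun k' => by
    rw [hset, ← linked_flip]
    exact (hik'.linked_iff_iso k').trans E.iso_flip
  rw [homLength_congr _ f, E.homLength_ideal_moduleTop] at h3
  simp only [hl] at h3
  exact_mod_cast h3

/-- The dimension conditions imply that the socles of the principal ideals are simple and match
the idempotents. -/
theorem hasSimpleSocles_of_dim (hess : IsEssential (socle S A)) (hess' : IsEssential (socle T A))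
    (ha : E.dim E.otherSocle = E.flip.dim (A ⧸ E.flip.ann (socle T A : Set A)))
    (hc : ∀ k, E.flip.dim (E.flip.component k) = E.dim (A ⧸ E.ann (E.flip.component k)))
    (hfin : ∀ k, E.flip.dim (E.flip.component k) ≠ ⊤)
    (ha' : E.flip.dim E.flip.otherSocle = E.dim (A ⧸ E.ann (socle S A : Set A)))
    (hc' : ∀ k, E.dim (E.component k) = E.flip.dim (A ⧸ E.flip.ann (E.component k)))
    (hfin' : ∀ k, E.dim (E.component k) ≠ ⊤) : E.HasSimpleSocles := by
  have hT : ∀ {i k}, E.Linked (socle T A) i k → _ := E.linked_iff_iso_of_dim ha hc hfin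
  have hS : ∀ {i k}, E.flip.Linked (socle S A) k i → _ :=
    E.flip.linked_iff_iso_of_dim ha' hc' hfin'
  have hmul : ∀ {i k}, E.Linked (socle S A) i k →
      E.Linked (socle T A) i k ∧ E.multiplicity i = E.multiplicity k := by
    intro i k hik
    obtain ⟨hk, hle, -⟩ := hS (E.linked_flip.2 hik)
    -- Essentiality of `S_r` applied to the right ideal `e_i S_l` gives `e_i (S_l ∩ S_r) e_k' ≠ 0`
    -- for some `k'`. By `hk` this `k'` is isomorphic to `k`, so `e_i S_r e_k ≠ 0`, and the
    -- inequalities from the two sides combine.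
    have hne : E.flip.otherSocle ⊓ E.flip.ideal i ≠ ⊥ :=
      (E.flip.exists_linked_iff (N := E.flip.otherSocle)).1 ⟨k, E.linked_flip.2 hik⟩
    have hne' : (socle T A ⊓ E.flip.otherSocle) ⊓ E.flip.ideal i ≠ ⊥ := by
      rw [inf_assoc]; exact hess' _ hne
    obtain ⟨k', z, ⟨hz, hz'⟩, h⟩ := E.flip.exists_linked_iff.2 hne'
    have h1 : E.Iso k' k := E.iso_flip.1 ((hk k').1 ⟨z, hz', h⟩)
    have h2 : E.flip.Linked (socle T A) k' i := ⟨z, hz, h⟩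
    have h3 : E.Linked (socle T A) i k := E.linked_flip.1
      (h2.of_iso (fun x hx r => (socle T A).smul_mem r hx) (E.iso_flip.2 h1))
    rw [multiplicity_flip, multiplicity_flip] at hle
    exact ⟨h3, le_antisymm (hT h3).2.1 hle⟩
  have hcol : ∀ k, ∃ i, E.Linked (socle S A) i k := fun k =>
    E.exists_linked_iff.2 (hess _ (E.ideal_ne_bot k))
  have hX : ∀ k, IsSimpleModule S ↥(E.otherSocle ⊓ E.ideal k) := fun k => by
    obtain ⟨i, hi⟩ := hcol k
    obtain ⟨h1, h2⟩ := hmul hi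
    exact (hT h1).2.2 h2
  have hle : E.otherSocle ≤ socle S A := E.le_of_inf_ideal_le E.otherSocle_twoSided fun k =>
    have := hX k
    le_socle_of_isSimpleModule _
  -- Essentiality gives `e_i S_r ≠ 0`; the inclusion `S_r ⊆ S_l` just obtained transfers this to
  -- `S_l`.
  have hrow : ∀ i, ∃ k, E.Linked (socle S A) i k := fun i => by
    obtain ⟨k, z, hz, h⟩ := E.flip.exists_linked_iff.2 (hess' _ (E.flip.ideal_ne_bot i))
    exact ⟨k, z, hle hz, h.1, h.2.2, h.2.1⟩
  have hY : ∀ i, IsSimpleModule T ↥(E.flip.otherSocle ⊓ E.flip.ideal i) := fun i => by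
    obtain ⟨k, hk⟩ := hrow i
    exact (hS (E.linked_flip.2 hk)).2.2 (by
      rw [multiplicity_flip, multiplicity_flip, (hmul hk).2])
  have hle' : E.flip.otherSocle ≤ socle T A :=
    E.flip.le_of_inf_ideal_le E.flip.otherSocle_twoSided fun i =>
      have := hY i
      le_socle_of_isSimpleModule _
  have h1 : E.otherSocle = socle S A := le_antisymm hle fun x hx => hle' hx
  have h2 : E.flip.otherSocle = socle T A := le_antisymm hle' fun x hx => hle hx
  exact ⟨fun x => ⟨fun h => hle' h, fun h => hle h⟩, fun k => h1 ▸ hX k, fun i => h2 ▸ hY i,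
    fun i k h => (hmul h).2⟩

end Essential

/-! ### Passage to and from Nakayama permutations -/

section Nakayama

variable {κ : Type} {rep : κ → ι} (hrep : ∀ i, ∃! k, E.Iso i (rep k))

include hrep in
/-- A Nakayama permutation respecting the multiplicities determines the multiplicities of the
simple modules in the socle. -/
theorem homLength_socle_of_perm (π : Equiv.Perm κ)
    (hπ : ∀ k, Nonempty (socle S (E.ideal (rep k)) ≃ₗ[S] E.Top (rep (π k))))
    (hm : ∀ k, E.multiplicity (rep k) = E.multiplicity (rep (π k))) (j : ι) :
    homLength (S := S) (E.ideal j) (socle S A) = E.multiplicity j := by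
  classical
  choose c hc hu using hrep
  have hciff : ∀ i k, E.Iso i (rep k) ↔ c i = k := fun i k =>
    ⟨fun h => (hu i k h).symm, fun h => h ▸ hc i⟩
  -- The socle of `A e_i` is the simple module of class `π (c i)`, so it contributes to `j` exactly
  -- when `c i = π⁻¹ (c j)`. The number of such `i` is the multiplicity of the class `π⁻¹ (c j)`,
  -- which is `μ_j` by `hm`.
  have h1 : ∀ i, homLength (S := S) (E.ideal j) ↥(socle S A ⊓ E.ideal i) =
      if E.Iso i (rep (π.symm (c j))) then 1 else 0 := fun i => by
    obtain ⟨f⟩ := E.iso_iff.1 (hc i)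
    obtain ⟨g⟩ := nonempty_socle_equiv f
    obtain ⟨l⟩ := hπ (c i)
    rw [homLength_congr _ (((socleEquiv _).symm.trans g).trans l), homLength_ideal_top]
    refine if_congr ?_ rfl rfl
    rw [hciff, hciff, Equiv.eq_symm_apply]
    exact eq_comm
  rw [E.homLength_eq_sum j _ E.socle_twoSided]
  simp only [h1, Finset.sum_boole]
  have h2 : E.multiplicity (rep (π.symm (c j))) = E.multiplicity j := by
    rw [hm, Equiv.apply_symm_apply, (hc j).multiplicity_eq]
  rw [← h2]
  rfl

-- Every row `e_k Z` has a nonzero component `e_k Z e_l`, with `l` chosen among the representatives.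
-- The column `Z e_l` determines the class of its row, so `k ↦ l` is injective on a finite set.
include hrep in
theorem HasSimpleSocles.exists_perm [Finite κ] (h : E.HasSimpleSocles) :
    ∃ π : Equiv.Perm κ, ∀ k, E.Linked (socle S A) (rep k) (rep (π k)) := by
  have hcl : ∀ {i k k'}, E.Linked (socle S A) i k → E.Iso k k' →
      E.Linked (socle S A) i k' := fun hik hk => (h.linked_iff_iso' hik _).2 hk.symm
  have hex : ∀ k, ∃ l, E.Linked (socle S A) (rep k) (rep l) := fun k => by
    obtain ⟨j, hj⟩ := h.exists_linked' (rep k)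
    obtain ⟨l, hl, -⟩ := hrep j
    exact ⟨l, hcl hj hl⟩
  choose p hp using hex
  have hinj : Function.Injective p := fun k k' hkk => by
    have h1 := hp k
    rw [hkk] at h1
    exact (hrep (rep k)).unique (Iso.refl E _) ((h.linked_iff_iso (hp k') (rep k)).1 h1)
  exact ⟨Equiv.ofBijective p (Finite.injective_iff_bijective.1 hinj), hp⟩

end Nakayama

end PeirceSystem

/-! ### Local idempotents: from endomorphisms of `eR` to elements of `eRe` -/

section LocalIdempotent

variable {R : Type u} [Ring R] {e : R}

theorem IsIdempotentElem.mem_principalRight (he : IsIdempotentElem e) {x : R} :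
    x ∈ principalRight e ↔ e * x = x := by
  constructor
  · intro h
    obtain ⟨r, rfl⟩ := Submodule.mem_span_singleton.1 h
    rw [mul_smul_comm, he.eq]
  · intro h
    rw [← h, ← op_smul_eq_mul]
    exact Submodule.smul_mem _ _ (Submodule.mem_span_singleton_self e)

/-- Left multiplication by an element of `eRe`, as an endomorphism of `eR`. -/
def mulLeftEnd (he : IsIdempotentElem e) (x : R) (hx : e * x = x) :
    Module.End Rᵐᵒᵖ (principalRight e) where
  toFun r := ⟨x * r, (IsIdempotentElem.mem_principalRight he).2 (by rw [← mul_assoc, hx])⟩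
  map_add' r r' := Subtype.ext (mul_add x (r : R) r')
  map_smul' c r := Subtype.ext (mul_smul_comm c x (r : R))

/-- An endomorphism of `eR` is determined by its value at `e`; the inverse of left multiplication by
`x` takes there the value `z`. -/
theorem exists_inv_of_isUnit_mulLeftEnd (he : IsIdempotentElem e) {x : R} (hx : e * x = x)
    (hx' : x * e = x) (h : IsUnit (mulLeftEnd he x hx)) : ∃ z, z * x = e ∧ x * z = e := by
  obtain ⟨g, hg, hg'⟩ := isUnit_iff_exists.1 h
  have hmem : e ∈ principalRight e := Submodule.mem_span_singleton_self e
  have hxm : x ∈ principalRight e := (IsIdempotentElem.mem_principalRight he).2 hx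
  refine ⟨g ⟨e, hmem⟩, ?_, ?_⟩
  · have h1 : g ⟨x, hxm⟩ = MulOpposite.op x • g ⟨e, hmem⟩ := by
      rw [← map_smul]
      exact congrArg g (Subtype.ext hx.symm)
    have h2 : mulLeftEnd he x hx ⟨e, hmem⟩ = ⟨x, hxm⟩ := Subtype.ext hx'
    have h3 := LinearMap.congr_fun hg' ⟨e, hmem⟩
    rw [Module.End.mul_apply, h2, h1] at h3
    exact congrArg Subtype.val h3
  · exact congrArg Subtype.val (LinearMap.congr_fun hg ⟨e, hmem⟩)

theorem IsLocalIdempotent.exists_inv (he : IsLocalIdempotent e) {x y : R} (hx : e * x = x)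
    (hx' : x * e = x) (hy : e * y = y) (hy' : y * e = y) (hxy : x + y = e) :
    (∃ z, z * x = e ∧ x * z = e) ∨ (∃ z, z * y = e ∧ y * z = e) := by
  have := he.2
  have hadd : mulLeftEnd he.1 x hx + mulLeftEnd he.1 y hy = 1 := by
    ext ⟨r, hr⟩
    change x * r + y * r = r
    rw [← add_mul, hxy, (IsIdempotentElem.mem_principalRight he.1).1 hr]
  exact (IsLocalRing.isUnit_or_isUnit_of_add_one hadd).imp
    (exists_inv_of_isUnit_mulLeftEnd he.1 hx hx') (exists_inv_of_isUnit_mulLeftEnd he.1 hy hy')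

theorem IsLocalIdempotent.ne_zero (he : IsLocalIdempotent e) : e ≠ 0 := by
  rintro rfl
  have := he.2.toNontrivial
  refine one_ne_zero (α := Module.End Rᵐᵒᵖ (principalRight (0 : R))) ?_
  ext ⟨r, hr⟩
  exact ((IsIdempotentElem.mem_principalRight he.1).1 hr).symm.trans (zero_mul r)

end LocalIdempotent

/-! ### Translation of the conditions for `R` into its Peirce system -/

namespace BasicSystem

variable {R : Type u} [Ring R] (E : BasicSystem R)

/-- The ring `R` with its left and right multiplications and a decomposition of its unit. -/
def peirce : PeirceSystem R Rᵐᵒᵖ R (Fin E.m) where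
  s := LinearEquiv.refl R R
  t :=
    { MulOpposite.opAddEquiv with
      map_smul' := fun _ _ => rfl }
  s_smul _ _ := rfl
  e := E.e
  idem i := (E.isLocal i).1
  ortho _ _ h := E.complete.ortho h
  s_sum := E.complete.complete
  t_sum := congrArg MulOpposite.op E.complete.complete
  e_ne_zero i := (E.isLocal i).ne_zero
  isLocal i _ _ h1 h2 h3 h4 h := (E.isLocal i).exists_inv h1 h2 h3 h4 h

theorem iso_iff {i j : Fin E.m} : E.peirce.Iso i j ↔
    Nonempty (principalRight (E.e i) ≃ₗ[Rᵐᵒᵖ] principalRight (E.e j)) :=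
  E.peirce.iso_flip.symm.trans E.peirce.flip.iso_iff

theorem existsUnique_iso (i : Fin E.m) : ∃! k, E.peirce.Iso i (E.rep k) := by
  simpa only [iso_iff] using E.existsUnique_rep i

theorem mult_eq (k : Fin E.n) : E.mult k = E.peirce.multiplicity (E.rep k) := by
  classical
  rw [mult, Nat.card_eq_fintype_card, Fintype.card_subtype, PeirceSystem.multiplicity]
  congr 1
  ext i
  simp only [Finset.mem_filter, iso_iff]

theorem leftDim_iff {M : Type u} [AddCommGroup M] [Module R M] {d : ℕ} :
    E.LeftDim M d ↔ E.peirce.dim M = d := by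
  rw [← E.peirce.hasLength_iff E.rep fun i => (E.existsUnique_iso i).exists]
  simp only [← mult_eq]
  rfl

theorem rightDim_iff {M : Type u} [AddCommGroup M] [Module Rᵐᵒᵖ M] {d : ℕ} :
    E.RightDim M d ↔ E.peirce.flip.dim M = d := by
  rw [← E.peirce.flip.hasLength_iff E.rep fun i =>
    (E.existsUnique_iso i).exists.imp fun _ => E.peirce.iso_flip.2]
  simp only [PeirceSystem.multiplicity_flip, ← mult_eq]
  rfl

theorem leftGDC_iff {I : Submodule R R} : E.LeftGDC I ↔
    E.peirce.dim I = E.peirce.flip.dim (R ⧸ rightAnn (I : Set R)) ∧ E.peirce.dim I ≠ ⊤ := by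
  simp only [LeftGDC, leftDim_iff, rightDim_iff]
  constructor
  · rintro ⟨d, h1, h2⟩
    rw [h1, h2]
    exact ⟨rfl, ENat.natCast_ne_top d⟩
  · rintro ⟨h1, h2⟩
    obtain ⟨d, hd⟩ := ENat.ne_top_iff_exists.1 h2
    exact ⟨d, hd.symm, by rw [← h1, hd]⟩

theorem rightGDC_iff {I : Submodule Rᵐᵒᵖ R} : E.RightGDC I ↔
    E.peirce.flip.dim I = E.peirce.dim (R ⧸ leftAnn (I : Set R)) ∧ E.peirce.flip.dim I ≠ ⊤ := by
  simp only [RightGDC, leftDim_iff, rightDim_iff]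
  constructor
  · rintro ⟨d, h1, h2⟩
    rw [h1, h2]
    exact ⟨rfl, ENat.natCast_ne_top d⟩
  · rintro ⟨h1, h2⟩
    obtain ⟨d, hd⟩ := ENat.ne_top_iff_exists.1 h2
    exact ⟨d, hd.symm, by rw [← h1, hd]⟩

theorem leftGDC_rightSocle_iff : E.LeftGDC (rightSocleAsLeft R) ↔
    E.peirce.dim E.peirce.otherSocle =
      E.peirce.flip.dim (R ⧸ E.peirce.flip.ann (rightSocle R : Set R)) ∧
    E.peirce.dim E.peirce.otherSocle ≠ ⊤ := E.leftGDC_iff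

theorem rightGDC_leftSocle_iff : E.RightGDC (leftSocleAsRight R) ↔
    E.peirce.flip.dim E.peirce.flip.otherSocle =
      E.peirce.dim (R ⧸ E.peirce.ann (leftSocle R : Set R)) ∧
    E.peirce.flip.dim E.peirce.flip.otherSocle ≠ ⊤ := E.rightGDC_iff

theorem rightGDC_component_iff (k : Fin E.n) : E.RightGDC (E.rightComponent k) ↔
    E.peirce.flip.dim (E.peirce.flip.component (E.rep k)) =
      E.peirce.dim (R ⧸ E.peirce.ann (E.peirce.flip.component (E.rep k) : Set R)) ∧
    E.peirce.flip.dim (E.peirce.flip.component (E.rep k)) ≠ ⊤ := E.rightGDC_iff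

theorem leftGDC_component_iff (k : Fin E.n) : E.LeftGDC (E.leftComponent k) ↔
    E.peirce.dim (E.peirce.component (E.rep k)) =
      E.peirce.flip.dim (R ⧸ E.peirce.flip.ann (E.peirce.component (E.rep k) : Set R)) ∧
    E.peirce.dim (E.peirce.component (E.rep k)) ≠ ⊤ := E.leftGDC_iff

end BasicSystem

end SemiperfectRing

theorem mainTheorem5 (R : Type u) [Ring R] (hR : SemiperfectRing.IsSemiperfect R)
    (hr : SemiperfectRing.IsEssential (SemiperfectRing.rightSocle R))
    (hl : SemiperfectRing.IsEssential (SemiperfectRing.leftSocle R))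
    (E : SemiperfectRing.BasicSystem R) :
    List.TFAE [
      ∃ π : Equiv.Perm (Fin E.n), E.IsNakayama π ∧ E.RespectsMultiplicities π,
      Nonempty (SemiperfectRing.leftSocle R ≃ₗ[R] SemiperfectRing.ModuleTop R R) ∧
        Nonempty (SemiperfectRing.rightSocle R ≃ₗ[Rᵐᵒᵖ] SemiperfectRing.ModuleTop Rᵐᵒᵖ R),
      SemiperfectRing.IsRightKasch R ∧
        E.LeftGDC (SemiperfectRing.rightSocleAsLeft R) ∧
        E.RightGDC (SemiperfectRing.leftSocleAsRight R) ∧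
        (∀ k, E.RightGDC (E.rightComponent k)) ∧
        (∀ k, E.LeftGDC (E.leftComponent k))] := by
  have hrep := E.existsUnique_iso
  have hrep' : ∀ i, ∃! k, E.peirce.flip.Iso i (E.rep k) := by
    simpa only [SemiperfectRing.PeirceSystem.iso_flip] using hrep
  tfae_have 1 → 2 := by
    rintro ⟨π, hπ, hm⟩
    have hm' : ∀ k, E.peirce.multiplicity (E.rep k) = E.peirce.multiplicity (E.rep (π k)) :=
      fun k => by rw [← E.mult_eq, ← E.mult_eq]; exact hm k
    constructor
    -- On the left side the socle of `R e_{π(k)}` has type `k`, so the permutation in play is `π⁻¹`.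
    · refine E.peirce.nonempty_socle_equiv_moduleTop fun i =>
        E.peirce.homLength_socle_of_perm hrep π.symm (fun k => ?_) (fun k => ?_) i
      · have := (hπ (π.symm k)).2
        rwa [Equiv.apply_symm_apply] at this
      · rw [hm' (π.symm k), Equiv.apply_symm_apply]
    · refine E.peirce.flip.nonempty_socle_equiv_moduleTop fun i =>
        E.peirce.flip.homLength_socle_of_perm hrep' π (fun k => (hπ k).1) (fun k => ?_) i
      rw [SemiperfectRing.PeirceSystem.multiplicity_flip, SemiperfectRing.PeirceSystem.multiplicity_flip, hm']
  have h21 : E.peirce.HasSimpleSocles →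
      ∃ π : Equiv.Perm (Fin E.n), E.IsNakayama π ∧ E.RespectsMultiplicities π := by
    intro h
    obtain ⟨π, hπ⟩ := h.exists_perm (E := E.peirce) hrep
    refine ⟨π, fun k => ⟨?_, ?_⟩, fun k => ?_⟩
    · refine h.flip.nonempty_socle_equiv (E.peirce.linked_flip.2 ?_)
      rw [← h.coe_socle_eq]
      exact hπ k
    · exact h.nonempty_socle_equiv (hπ k)
    · rw [E.mult_eq, E.mult_eq]
      exact h.multiplicity_eq _ _ (hπ k)
  have h23 : Nonempty (SemiperfectRing.leftSocle R ≃ₗ[R] SemiperfectRing.ModuleTop R R) ∧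
      Nonempty (SemiperfectRing.rightSocle R ≃ₗ[Rᵐᵒᵖ] SemiperfectRing.ModuleTop Rᵐᵒᵖ R) →
        E.peirce.HasSimpleSocles :=
    fun ⟨⟨f⟩, ⟨g⟩⟩ => E.peirce.hasSimpleSocles_of_equiv hl hr f g
  tfae_have 2 → 1 := fun h => h21 (h23 h)
  tfae_have 2 → 3 := by
    intro h2
    have h := h23 h2
    refine ⟨fun V _ _ _ => ?_, ?_, ?_, fun k => ?_, fun k => ?_⟩
    -- Right Kasch: a simple right module is some `top(e_k R)`, and this is the socle of the `e_i R`
    -- that is matched with `k`.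
    · obtain ⟨k, ⟨f⟩⟩ := E.peirce.flip.exists_top_equiv V
      obtain ⟨i, hi⟩ := h.flip.exists_linked' k
      have := h.flip.isSimpleModule i
      obtain ⟨g⟩ := hi.nonempty_top_equiv
      exact ⟨_, ⟨f.symm.trans g⟩⟩
    · rw [E.leftGDC_rightSocle_iff, h.dim_otherSocle, h.dim_quotient_ann]
      exact ⟨rfl, ENat.sum_ne_top.2 fun i _ => ENat.natCast_ne_top _⟩
    · rw [E.rightGDC_leftSocle_iff, h.flip.dim_otherSocle]
      exact ⟨h.flip.dim_quotient_ann.symm, ENat.sum_ne_top.2 fun i _ => ENat.natCast_ne_top _⟩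
    · rw [E.rightGDC_component_iff, h.flip.dim_component]
      exact ⟨(h.flip.dim_quotient_ann_component _).symm, ENat.natCast_ne_top _⟩
    · rw [E.leftGDC_component_iff, h.dim_component, h.dim_quotient_ann_component]
      exact ⟨rfl, ENat.natCast_ne_top _⟩
  tfae_have 3 → 1 := by
    rintro ⟨-, h1, h2, h3, h4⟩
    rw [E.leftGDC_rightSocle_iff] at h1
    rw [E.rightGDC_leftSocle_iff] at h2
    simp only [E.rightGDC_component_iff] at h3
    simp only [E.leftGDC_component_iff] at h4
    -- Isomorphic idempotents have the same component, so the conditions for basic idempotents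
    -- extend to all `i ≤ m`.
    have h3' : ∀ i, E.peirce.flip.dim (E.peirce.flip.component i) =
        E.peirce.dim (R ⧸ E.peirce.ann (E.peirce.flip.component i : Set R)) ∧
        E.peirce.flip.dim (E.peirce.flip.component i) ≠ ⊤ := fun i => by
      obtain ⟨k, hk, -⟩ := hrep' i
      rw [hk.component_eq]
      exact h3 k
    have h4' : ∀ i, E.peirce.dim (E.peirce.component i) =
        E.peirce.flip.dim (R ⧸ E.peirce.flip.ann (E.peirce.component i : Set R)) ∧
        E.peirce.dim (E.peirce.component i) ≠ ⊤ := fun i => by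
      obtain ⟨k, hk, -⟩ := hrep i
      rw [hk.component_eq]
      exact h4 k
    exact h21 (E.peirce.hasSimpleSocles_of_dim hl hr h1.1 (fun i => (h3' i).1)
      (fun i => (h3' i).2) h2.1 (fun i => (h4' i).1) fun i => (h4' i).2)
  tfae_finish
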